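/- Notation. Let $H$ be the upper half-plane, $\eta$ the Dedekind eta function and $G^+(\mathbb Q)=\mathrm{GL}^+(2,\mathbb Q)$, acting on functions on $H$ by $$(f|_k\gamma)(z)=\det(\gamma)^{k/2}f(\gamma z)(cz+d)^{-k},\qquad \gamma=\begin{pmatrix}a&b\\c&d\end{pmatrix}.$$ Let $\mathcal M=\bigoplus_{k\ge 0}\mathcal M_k$ be the graded algebra of modular forms of all levels, $\mathcal M_k=\bigcup_{N\ge1}\mathcal M_k(\Gamma(N))$, and let $\mathcal A_{G^+(\mathbb Q)}=\mathcal M\rtimes G^+(\mathbb Q)$ be the crossed product, whose elements are the finite sums of symbols $f\,U_\gamma^*$ ($f\in\mathcal M$, $\gamma\in G^+(\mathbb Q)$), with product $fU_\alpha^*\cdot gU_\beta^*=(f\cdot g|\alpha)\,U_{\beta\alpha}^*$. Let $\mathcal H_1$ be the Hopf algebra which, as an algebra, is the universal enveloping algebra of the complex Lie algebra with basis $X,Y,\delta_n$ $(n\ge1)$ and brackets $[Y,X]=X$, $[Y,\delta_n]=n\delta_n$, $[X,\delta_n]=\delta_{n+1}$, $[\delta_k,\delta_l]=0$, with coproduct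 the algebra homomorphism such that $\Delta Y=Y\otimes1+1\otimes Y$, $\Delta\delta_1=\delta_1\otimes1+1\otimes\delta_1$, $\Delta X=X\otimes1+1\otimes X+\delta_1\otimes Y$, with counit vanishing on $X,Y,\delta_n$, and with antipode determined by $S(Y)=-Y$, $S(\delta_1)=-\delta_1$, $S(X)=-X+\delta_1Y$. A Hopf action of $\mathcal H_1$ on an algebra is an action with $h(ab)=\sum h_{(1)}(a)h_{(2)}(b)$ and $h(1)=\varepsilon(h)1$. On $\mathcal M_k$ put $Y(f)=\frac k2 f$ and $X(f)=\frac1{2\pi i}\frac{df}{dz}-\frac1{2\pi i}\left(\frac{d}{dz}\log\eta^4\right)Y(f)\in\mathcal M_{k+2}$, and for $\gamma\in G^+(\mathbb Q)$ let $\mu_\gamma=\frac1{2\pi i}\frac{d}{dz}\log\frac{\eta^4|_2\gamma}{\eta^4}\in\mathcal M_2$. Let $$Z(z)=\frac{2\pi i}{6}\int_{i\infty}^z\eta^4\,dz,\qquad \frac{d}{dZ}F=\frac{dF/dz}{dZ/dz}.$$ Statement. There is a unique Hopf action of $\mathcal H_1$ on $\mathcal A_{G^+(\mathbb Q)}$ with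 $X(fU_\gamma^*)=X(f)U_\gamma^*$, $Y(fU_\gamma^*)=Y(f)U_\gamma^*$, $\delta_1(fU_\gamma^*)=\mu_\gamma f\,U_\gamma^*$. The function $Z$ is holomorphic on $H$ with $dZ=\frac{2\pi i}{6}\eta^4\,dz$, and for every $\gamma\in G^+(\mathbb Q)$ the function $\frac{d(Z|_0\gamma)}{dZ}$ has a holomorphic logarithm on $H$. In the above action, for all $n\ge1$, $k\ge 0$, $f\in\mathcal M_k$, $\gamma\in G^+(\mathbb Q)$ and every choice of this logarithm, $$\delta_n(f\,U_\gamma^*)=\left(\frac{d}{dZ}\right)^n\left(\log\frac{d(Z|_0\gamma)}{dZ}\right)(dZ)^n\,f\,U_\gamma^*.$$ Here modular forms are identified with higher differentials, $f\in\mathcal M_k$ standing for $f\cdot(2\pi i\,dz)^{k/2}$; that is, $\delta_n(fU_\gamma^*)=g\,U_\gamma^*$, where $g\in\mathcal M_{k+2n}$ is the function $$g=\left(\frac{d}{dZ}\right)^n\left(\log\frac{d(Z|_0\gamma)}{dZ}\right)\cdot\left(\frac1{2\pi i}\frac{dZ}{dz}\right)^n\cdot f .$$ -/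

import Mathlib

noncomputable section

namespace ModularHecke

open UpperHalfPlane hiding I
open ModularForm CongruenceSubgroup Derivative
open scoped TensorProduct MatrixGroups DirectSum Manifold ModularForm

/-! ### The Hopf algebra `ℋ₁` -/

/-- The basis `X, Y, δ_n (n ≥ 1)` of the Lie algebra. -/
inductive H1Gen : Type
  | X : H1Gen
  | Y : H1Gen
  | delta (n : ℕ+) : H1Gen

/-- The bracket relations `[Y,X] = X`, `[Y,δ_n] = n δ_n`, `[X,δ_n] = δ_{n+1}`, `[δ_k,δ_l] = 0`. -/
inductive H1Rel : FreeAlgebra ℂ H1Gen → FreeAlgebra ℂ H1Gen → Prop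
  | YX : H1Rel
      (FreeAlgebra.ι ℂ H1Gen.Y * FreeAlgebra.ι ℂ H1Gen.X
        - FreeAlgebra.ι ℂ H1Gen.X * FreeAlgebra.ι ℂ H1Gen.Y)
      (FreeAlgebra.ι ℂ H1Gen.X)
  | Yd (n : ℕ+) : H1Rel
      (FreeAlgebra.ι ℂ H1Gen.Y * FreeAlgebra.ι ℂ (H1Gen.delta n)
        - FreeAlgebra.ι ℂ (H1Gen.delta n) * FreeAlgebra.ι ℂ H1Gen.Y)
      (((n : ℕ) : ℂ) • FreeAlgebra.ι ℂ (H1Gen.delta n))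
  | Xd (n : ℕ+) : H1Rel
      (FreeAlgebra.ι ℂ H1Gen.X * FreeAlgebra.ι ℂ (H1Gen.delta n)
        - FreeAlgebra.ι ℂ (H1Gen.delta n) * FreeAlgebra.ι ℂ H1Gen.X)
      (FreeAlgebra.ι ℂ (H1Gen.delta (n + 1)))
  | dd (k l : ℕ+) : H1Rel
      (FreeAlgebra.ι ℂ (H1Gen.delta k) * FreeAlgebra.ι ℂ (H1Gen.delta l)
        - FreeAlgebra.ι ℂ (H1Gen.delta l) * FreeAlgebra.ι ℂ (H1Gen.delta k))
      0

/-- `ℋ₁` as an algebra: the universal enveloping algebra of the complex Lie algebra with basis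
`X, Y, δ_n` and the brackets above, given by generators and relations. -/
def H1 : Type := RingQuot H1Rel

instance : Ring H1 := inferInstanceAs (Ring (RingQuot H1Rel))

instance : Algebra ℂ H1 := inferInstanceAs (Algebra ℂ (RingQuot H1Rel))

namespace H1

/-- The quotient map from the free algebra on `X, Y, δ_n`. -/
def mk : FreeAlgebra ℂ H1Gen →ₐ[ℂ] H1 := RingQuot.mkAlgHom ℂ H1Rel

theorem mk_rel {a b : FreeAlgebra ℂ H1Gen} (h : H1Rel a b) : mk a = mk b :=
  RingQuot.mkAlgHom_rel ℂ h

/-- The images of the generators in `ℋ₁`. -/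
def gen (g : H1Gen) : H1 := mk (FreeAlgebra.ι ℂ g)

/-- The element `X ∈ ℋ₁`. -/
def X : H1 := gen H1Gen.X

/-- The element `Y ∈ ℋ₁`. -/
def Y : H1 := gen H1Gen.Y

/-- The element `δ_n ∈ ℋ₁`, `n ≥ 1`. -/
def delta (n : ℕ+) : H1 := gen (H1Gen.delta n)

theorem Y_X : Y * X - X * Y = X := by
  simpa [X, Y, gen] using mk_rel H1Rel.YX

theorem Y_delta (n : ℕ+) : Y * delta n - delta n * Y = ((n : ℕ) : ℂ) • delta n := by
  simpa only [map_sub, map_mul, map_smul, gen, X, Y, delta] using mk_rel (H1Rel.Yd n)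

theorem X_delta (n : ℕ+) : X * delta n - delta n * X = delta (n + 1) := by
  simpa only [map_sub, map_mul, gen, X, Y, delta] using mk_rel (H1Rel.Xd n)

theorem delta_comm (k l : ℕ+) : delta k * delta l = delta l * delta k := by
  have h := mk_rel (H1Rel.dd k l)
  rw [map_sub, map_mul, map_mul, map_zero] at h
  exact sub_eq_zero.mp h

section lift

variable {B : Type*} [Ring B] [Algebra ℂ B]

/-- The values of an algebra map on generators, from the values at `X`, `Y`, `δ_n`. -/
def genFun (x y : B) (d : ℕ+ → B) : H1Gen → B
  | H1Gen.X => x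
  | H1Gen.Y => y
  | H1Gen.delta n => d n

/-- The universal property of `ℋ₁` as an enveloping algebra. -/
def lift (x y : B) (d : ℕ+ → B) (hyx : y * x - x * y = x)
    (hyd : ∀ n : ℕ+, y * d n - d n * y = ((n : ℕ) : ℂ) • d n)
    (hxd : ∀ n : ℕ+, x * d n - d n * x = d (n + 1))
    (hdd : ∀ k l : ℕ+, d k * d l = d l * d k) : H1 →ₐ[ℂ] B :=
  RingQuot.liftAlgHom ℂ ⟨FreeAlgebra.lift ℂ (genFun x y d), by
    intro a b h
    cases h with
    | YX => simpa [genFun] using hyx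
    | Yd n => simpa [genFun] using hyd n
    | Xd n => simpa [genFun] using hxd n
    | dd k l => simpa [genFun, sub_eq_zero] using hdd k l⟩

variable (x y : B) (d : ℕ+ → B) (hyx : y * x - x * y = x)
    (hyd : ∀ n : ℕ+, y * d n - d n * y = ((n : ℕ) : ℂ) • d n)
    (hxd : ∀ n : ℕ+, x * d n - d n * x = d (n + 1))
    (hdd : ∀ k l : ℕ+, d k * d l = d l * d k)

theorem lift_X : lift x y d hyx hyd hxd hdd X = x := by
  refine (RingQuot.liftAlgHom_mkAlgHom_apply ..).trans ?_
  simp [genFun]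

theorem lift_Y : lift x y d hyx hyd hxd hdd Y = y := by
  refine (RingQuot.liftAlgHom_mkAlgHom_apply ..).trans ?_
  simp [genFun]

theorem lift_delta (n : ℕ+) : lift x y d hyx hyd hxd hdd (delta n) = d n := by
  refine (RingQuot.liftAlgHom_mkAlgHom_apply ..).trans ?_
  simp [genFun]

/-- `ℋ₁` is generated by `X`, `Y` and `δ₁`. -/
theorem hom_ext {f g : H1 →ₐ[ℂ] B} (hX : f X = g X) (hY : f Y = g Y)
    (hd : f (delta 1) = g (delta 1)) : f = g := by
  have hdn : ∀ n : ℕ+, f (delta n) = g (delta n) := by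
    intro n
    induction n using PNat.recOn with
    | one => exact hd
    | succ n ih => rw [← X_delta, map_sub, map_sub, map_mul, map_mul, map_mul, map_mul, hX, ih]
  refine RingQuot.ringQuot_ext' (S := ℂ) (s := H1Rel) f g (FreeAlgebra.hom_ext (funext fun a => ?_))
  cases a with
  | X => exact hX
  | Y => exact hY
  | delta n => exact hdn n

end lift

/-- `Δ X = X ⊗ 1 + 1 ⊗ X + δ₁ ⊗ Y`. -/
def comulX : H1 ⊗[ℂ] H1 := X ⊗ₜ 1 + 1 ⊗ₜ X + delta 1 ⊗ₜ Y

/-- `Δ Y = Y ⊗ 1 + 1 ⊗ Y`. -/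
def comulY : H1 ⊗[ℂ] H1 := Y ⊗ₜ 1 + 1 ⊗ₜ Y

/-- `Δ δ₁ = δ₁ ⊗ 1 + 1 ⊗ δ₁` and `Δ δ_{n+1} = [Δ X, Δ δ_n]`. -/
def comulDelta (n : ℕ+) : H1 ⊗[ℂ] H1 :=
  PNat.recOn n (delta 1 ⊗ₜ 1 + 1 ⊗ₜ delta 1) (fun _ t => comulX * t - t * comulX)

theorem comulDelta_one : comulDelta 1 = delta 1 ⊗ₜ 1 + 1 ⊗ₜ delta 1 := PNat.recOn_one _ _

theorem comulDelta_succ (n : ℕ+) :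
    comulDelta (n + 1) = comulX * comulDelta n - comulDelta n * comulX := PNat.recOn_succ _ _ _

theorem comul_Y_X : comulY * comulX - comulX * comulY = comulX := by
  have h1 : Y * X = X * Y + X := by rw [← sub_eq_iff_eq_add']; exact Y_X
  have h2 : Y * delta 1 = delta 1 * Y + delta 1 := by
    rw [← sub_eq_iff_eq_add']; simpa using Y_delta 1
  simp only [comulX, comulY, mul_add, add_mul, Algebra.TensorProduct.tmul_mul_tmul, mul_one,
    one_mul, h1, h2, TensorProduct.add_tmul, TensorProduct.tmul_add]
  abel

theorem comul_Y_delta (n : ℕ+) :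
    comulY * comulDelta n - comulDelta n * comulY = ((n : ℕ) : ℂ) • comulDelta n := by
  induction n using PNat.recOn with
  | one =>
    have h2 : Y * delta 1 = delta 1 * Y + delta 1 := by
      rw [← sub_eq_iff_eq_add']; simpa using Y_delta 1
    simp only [comulDelta_one, comulY, mul_add, add_mul, Algebra.TensorProduct.tmul_mul_tmul,
      mul_one, one_mul, h2, TensorProduct.add_tmul, TensorProduct.tmul_add, PNat.one_coe,
      Nat.cast_one, one_smul]
    abel
  | succ n ih =>
    have e : comulY * (comulX * comulDelta n - comulDelta n * comulX)
        - (comulX * comulDelta n - comulDelta n * comulX) * comulY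
        = ((comulY * comulX - comulX * comulY) * comulDelta n
            - comulDelta n * (comulY * comulX - comulX * comulY))
          + (comulX * (comulY * comulDelta n - comulDelta n * comulY)
            - (comulY * comulDelta n - comulDelta n * comulY) * comulX) := by
      noncomm_ring
    rw [comulDelta_succ, e, ih, comul_Y_X, mul_smul_comm, smul_mul_assoc, ← smul_sub,
      PNat.add_coe, PNat.one_coe, Nat.cast_add, Nat.cast_one, add_smul, one_smul, add_comm]

/-- The elements `δ_i ⊗ 1` and `1 ⊗ δ_i` of `ℋ₁ ⊗ ℋ₁`. -/
def deltaTensors : Set (H1 ⊗[ℂ] H1) :=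
  {t | ∃ i : ℕ+, t = delta i ⊗ₜ 1 ∨ t = 1 ⊗ₜ delta i}

theorem comulDelta_mem (n : ℕ+) : comulDelta n ∈ Algebra.adjoin ℂ deltaTensors := by
  have hl (i : ℕ+) : delta i ⊗ₜ[ℂ] (1 : H1) ∈ Algebra.adjoin ℂ deltaTensors :=
    Algebra.subset_adjoin ⟨i, Or.inl rfl⟩
  have hr (i : ℕ+) : (1 : H1) ⊗ₜ[ℂ] delta i ∈ Algebra.adjoin ℂ deltaTensors :=
    Algebra.subset_adjoin ⟨i, Or.inr rfl⟩
  induction n using PNat.recOn with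
  | one => rw [comulDelta_one]; exact add_mem (hl 1) (hr 1)
  | succ n ih =>
    rw [comulDelta_succ]
    generalize comulDelta n = t at ih ⊢
    induction ih using Algebra.adjoin_induction with
    | mem t ht =>
      obtain ⟨i, rfl | rfl⟩ := ht
      · have : comulX * delta i ⊗ₜ[ℂ] (1 : H1) - delta i ⊗ₜ[ℂ] (1 : H1) * comulX
            = delta (i + 1) ⊗ₜ[ℂ] (1 : H1) := by
          simp only [comulX, mul_add, add_mul, Algebra.TensorProduct.tmul_mul_tmul, mul_one,
            one_mul, ← X_delta, TensorProduct.sub_tmul, delta_comm 1 i]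
          abel
        rw [this]; exact hl _
      · have : comulX * (1 : H1) ⊗ₜ[ℂ] delta i - (1 : H1) ⊗ₜ[ℂ] delta i * comulX
            = (1 : H1) ⊗ₜ[ℂ] delta (i + 1)
              + ((i : ℕ) : ℂ) • ((delta 1 ⊗ₜ[ℂ] (1 : H1)) * ((1 : H1) ⊗ₜ[ℂ] delta i)) := by
          simp only [comulX, mul_add, add_mul, Algebra.TensorProduct.tmul_mul_tmul, mul_one,
            one_mul, ← X_delta, ← TensorProduct.tmul_smul, ← Y_delta, TensorProduct.tmul_sub]
          abel
        rw [this]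
        exact add_mem (hr _) (Subalgebra.smul_mem _ (mul_mem (hl _) (hr _)) _)
    | algebraMap r => rw [Algebra.commutes, sub_self]; exact zero_mem _
    | add s t _ _ hs ht =>
      have : comulX * (s + t) - (s + t) * comulX
          = (comulX * s - s * comulX) + (comulX * t - t * comulX) := by noncomm_ring
      rw [this]; exact add_mem hs ht
    | mul s t hs' ht' hs ht =>
      have : comulX * (s * t) - (s * t) * comulX
          = (comulX * s - s * comulX) * t + s * (comulX * t - t * comulX) := by noncomm_ring
      rw [this]; exact add_mem (mul_mem hs ht') (mul_mem hs' ht)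

theorem comulDelta_comm (k l : ℕ+) :
    comulDelta k * comulDelta l = comulDelta l * comulDelta k := by
  refine Algebra.commute_of_mem_adjoin_of_forall_mem_commute (comulDelta_mem l) ?_
  intro t ht
  refine (Algebra.commute_of_mem_adjoin_of_forall_mem_commute (comulDelta_mem k) ?_).symm
  intro s hs
  obtain ⟨i, rfl | rfl⟩ := ht <;> obtain ⟨j, rfl | rfl⟩ := hs <;>
    simp [Commute, SemiconjBy, Algebra.TensorProduct.tmul_mul_tmul, delta_comm i j]

/-- The coproduct of `ℋ₁`. -/
def comulHom : H1 →ₐ[ℂ] H1 ⊗[ℂ] H1 :=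
  lift comulX comulY comulDelta comul_Y_X comul_Y_delta (fun n => (comulDelta_succ n).symm)
    comulDelta_comm

/-- The counit of `ℋ₁`: the constant term. -/
def counitHom : H1 →ₐ[ℂ] ℂ :=
  lift 0 0 (fun _ => 0) (by simp) (by simp) (by simp) (by simp)

theorem comulHom_X : comulHom X = X ⊗ₜ 1 + 1 ⊗ₜ X + delta 1 ⊗ₜ Y := lift_X ..

theorem comulHom_Y : comulHom Y = Y ⊗ₜ 1 + 1 ⊗ₜ Y := lift_Y ..

theorem comulHom_delta_one : comulHom (delta 1) = delta 1 ⊗ₜ 1 + 1 ⊗ₜ delta 1 :=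
  (lift_delta ..).trans comulDelta_one

theorem counitHom_X : counitHom X = 0 := lift_X ..

theorem counitHom_Y : counitHom Y = 0 := lift_Y ..

theorem counitHom_delta (n : ℕ+) : counitHom (delta n) = 0 := lift_delta ..

instance : Bialgebra ℂ H1 :=
  Bialgebra.ofAlgHom comulHom counitHom
    (by
      apply hom_ext <;>
        simp [comulHom_X, comulHom_Y, comulHom_delta_one, TensorProduct.add_tmul,
          TensorProduct.tmul_add, Algebra.TensorProduct.one_def] <;> abel)
    (by
      apply hom_ext <;>
        simp [comulHom_X, comulHom_Y, comulHom_delta_one, counitHom_X, counitHom_Y,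
          counitHom_delta])
    (by
      apply hom_ext <;>
        simp [comulHom_X, comulHom_Y, comulHom_delta_one, counitHom_X, counitHom_Y,
          counitHom_delta])

/-- A subalgebra that contains `X`, `Y` and `δ₁` is everything. -/
theorem mem_of_gen (P : Subalgebra ℂ H1) (hX : X ∈ P) (hY : Y ∈ P) (hd : delta 1 ∈ P) (h : H1) :
    h ∈ P := by
  have hdn : ∀ n : ℕ+, delta n ∈ P := by
    intro n
    induction n using PNat.recOn with
    | one => exact hd
    | succ n ih => rw [← X_delta]; exact sub_mem (mul_mem hX ih) (mul_mem ih hX)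
  obtain ⟨a, rfl⟩ := RingQuot.mkAlgHom_surjective ℂ H1Rel h
  change mk a ∈ P
  induction a using FreeAlgebra.induction with
  | grade0 r => rw [AlgHom.commutes]; exact P.algebraMap_mem r
  | grade1 g =>
    cases g with
    | X => exact hX
    | Y => exact hY
    | delta n => exact hdn n
  | mul a b ha hb => rw [map_mul]; exact mul_mem ha hb
  | add a b ha hb => rw [map_add]; exact add_mem ha hb

/-- `S X = -X + δ₁ Y`. -/
def antiX : H1 := -X + delta 1 * Y

/-- `S δ₁ = -δ₁` and `S δ_{n+1} = S [X, δ_n] = [S δ_n, S X]`. -/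
def antiDelta (n : ℕ+) : H1 :=
  PNat.recOn n (-delta 1) (fun _ t => t * antiX - antiX * t)

theorem antiDelta_one : antiDelta 1 = -delta 1 := PNat.recOn_one _ _

theorem antiDelta_succ (n : ℕ+) :
    antiDelta (n + 1) = antiDelta n * antiX - antiX * antiDelta n := PNat.recOn_succ _ _ _

theorem anti_Y_X : antiX * -Y - -Y * antiX = antiX := by
  have h1 : Y * X = X * Y + X := by rw [← sub_eq_iff_eq_add']; exact Y_X
  have h2 : Y * delta 1 = delta 1 * Y + delta 1 := by
    rw [← sub_eq_iff_eq_add']; simpa using Y_delta 1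
  have e : antiX * -Y - -Y * antiX
      = X * Y - Y * X - delta 1 * Y * Y + (Y * delta 1) * Y := by
    unfold antiX; noncomm_ring
  rw [e, h1, h2, antiX]
  noncomm_ring

theorem anti_Y_delta (n : ℕ+) :
    antiDelta n * -Y - -Y * antiDelta n = ((n : ℕ) : ℂ) • antiDelta n := by
  induction n using PNat.recOn with
  | one =>
    have h2 : Y * delta 1 = delta 1 * Y + delta 1 := by
      rw [← sub_eq_iff_eq_add']; simpa using Y_delta 1
    simp [antiDelta_one, h2]
  | succ n ih =>
    have e : (antiDelta n * antiX - antiX * antiDelta n) * -Y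
        - -Y * (antiDelta n * antiX - antiX * antiDelta n)
        = (antiDelta n * (antiX * -Y - -Y * antiX) - (antiX * -Y - -Y * antiX) * antiDelta n)
          + ((antiDelta n * -Y - -Y * antiDelta n) * antiX
            - antiX * (antiDelta n * -Y - -Y * antiDelta n)) := by
      noncomm_ring
    rw [antiDelta_succ, e, ih, anti_Y_X, mul_smul_comm, smul_mul_assoc, ← smul_sub,
      PNat.add_coe, PNat.one_coe, Nat.cast_add, Nat.cast_one, add_smul, one_smul, add_comm]

theorem antiDelta_mem (n : ℕ+) : antiDelta n ∈ Algebra.adjoin ℂ (Set.range delta) := by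
  have hd (i : ℕ+) : delta i ∈ Algebra.adjoin ℂ (Set.range delta) :=
    Algebra.subset_adjoin ⟨i, rfl⟩
  induction n using PNat.recOn with
  | one => rw [antiDelta_one]; exact neg_mem (hd 1)
  | succ n ih =>
    rw [antiDelta_succ]
    generalize antiDelta n = t at ih ⊢
    induction ih using Algebra.adjoin_induction with
    | mem t ht =>
      obtain ⟨i, rfl⟩ := ht
      have : delta i * antiX - antiX * delta i
          = delta (i + 1) + ((i : ℕ) : ℂ) • (-(delta 1 * delta i)) := by
        have e : delta i * antiX - antiX * delta i = (X * delta i - delta i * X)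
            - delta 1 * (Y * delta i - delta i * Y)
            + (delta i * delta 1 - delta 1 * delta i) * Y := by unfold antiX; noncomm_ring
        rw [e, X_delta, Y_delta, delta_comm i 1, mul_smul_comm, smul_neg]
        noncomm_ring
      rw [this]
      exact add_mem (hd _) (Subalgebra.smul_mem _ (neg_mem (mul_mem (hd _) (hd _))) _)
    | algebraMap r => rw [Algebra.commutes, sub_self]; exact zero_mem _
    | add s t _ _ hs ht =>
      have : (s + t) * antiX - antiX * (s + t)
          = (s * antiX - antiX * s) + (t * antiX - antiX * t) := by noncomm_ring
      rw [this]; exact add_mem hs ht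
    | mul s t hs' ht' hs ht =>
      have : (s * t) * antiX - antiX * (s * t)
          = (s * antiX - antiX * s) * t + s * (t * antiX - antiX * t) := by noncomm_ring
      rw [this]; exact add_mem (mul_mem hs ht') (mul_mem hs' ht)

theorem antiDelta_comm (k l : ℕ+) : antiDelta k * antiDelta l = antiDelta l * antiDelta k := by
  refine Algebra.commute_of_mem_adjoin_of_forall_mem_commute (antiDelta_mem l) ?_
  intro t ht
  refine (Algebra.commute_of_mem_adjoin_of_forall_mem_commute (antiDelta_mem k) ?_).symm
  intro s hs
  obtain ⟨i, rfl⟩ := ht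
  obtain ⟨j, rfl⟩ := hs
  exact delta_comm i j

/-- The antipode as an algebra map to the opposite algebra. -/
def antiHom : H1 →ₐ[ℂ] H1ᵐᵒᵖ :=
  lift (MulOpposite.op antiX) (MulOpposite.op (-Y)) (fun n => MulOpposite.op (antiDelta n))
    (congrArg MulOpposite.op anti_Y_X)
    (fun n => congrArg MulOpposite.op (anti_Y_delta n))
    (fun n => congrArg MulOpposite.op (antiDelta_succ n).symm)
    (fun k l => congrArg MulOpposite.op (antiDelta_comm l k))

/-- The antipode of `ℋ₁`: the anti-homomorphism with `S X = -X + δ₁ Y`, `S Y = -Y`,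
`S δ₁ = -δ₁`. -/
def antipodeLin : H1 →ₗ[ℂ] H1 :=
  (MulOpposite.opLinearEquiv ℂ).symm.toLinearMap ∘ₗ antiHom.toLinearMap

theorem antipodeLin_mul (a b : H1) : antipodeLin (a * b) = antipodeLin b * antipodeLin a := by
  simp [antipodeLin]

theorem antipodeLin_one : antipodeLin 1 = 1 := by simp [antipodeLin]

theorem antipodeLin_X : antipodeLin X = -X + delta 1 * Y := by
  simp only [antipodeLin, LinearMap.comp_apply, AlgHom.toLinearMap_apply, antiHom, lift_X]
  rfl

theorem antipodeLin_Y : antipodeLin Y = -Y := by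
  simp only [antipodeLin, LinearMap.comp_apply, AlgHom.toLinearMap_apply, antiHom, lift_Y]
  rfl

theorem antipodeLin_delta_one : antipodeLin (delta 1) = -delta 1 := by
  simp only [antipodeLin, LinearMap.comp_apply, AlgHom.toLinearMap_apply, antiHom, lift_delta]
  exact antiDelta_one

/-- The linear map `a ⊗ b ↦ S(a) b`. -/
def convL : H1 ⊗[ℂ] H1 →ₗ[ℂ] H1 := LinearMap.mul' ℂ H1 ∘ₗ antipodeLin.rTensor H1

/-- The linear map `a ⊗ b ↦ a S(b)`. -/
def convR : H1 ⊗[ℂ] H1 →ₗ[ℂ] H1 := LinearMap.mul' ℂ H1 ∘ₗ antipodeLin.lTensor H1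

theorem convL_tmul (a b : H1) : convL (a ⊗ₜ b) = antipodeLin a * b := by simp [convL]

theorem convR_tmul (a b : H1) : convR (a ⊗ₜ b) = a * antipodeLin b := by simp [convR]

theorem convL_mul (t u : H1 ⊗[ℂ] H1) {r : ℂ} (ht : convL t = algebraMap ℂ H1 r) :
    convL (t * u) = r • convL u := by
  induction u using TensorProduct.induction_on with
  | zero => simp
  | add u v hu hv => rw [mul_add, map_add, map_add, hu, hv, smul_add]
  | tmul c d =>
    have key : ∀ t : H1 ⊗[ℂ] H1, convL (t * c ⊗ₜ d) = antipodeLin c * convL t * d := by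
      intro t
      induction t using TensorProduct.induction_on with
      | zero => simp
      | add u v hu hv => rw [add_mul, map_add, map_add, hu, hv, mul_add, add_mul]
      | tmul a b =>
        rw [Algebra.TensorProduct.tmul_mul_tmul, convL_tmul, convL_tmul, antipodeLin_mul]
        simp only [mul_assoc]
    rw [key, ht, convL_tmul, ← Algebra.commutes, Algebra.smul_def, mul_assoc]

theorem convR_mul (t u : H1 ⊗[ℂ] H1) {r : ℂ} (hu : convR u = algebraMap ℂ H1 r) :
    convR (t * u) = r • convR t := by
  induction t using TensorProduct.induction_on with
  | zero => simp
  | add t v ht hv => rw [add_mul, map_add, map_add, ht, hv, smul_add]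
  | tmul a b =>
    have key : ∀ u : H1 ⊗[ℂ] H1, convR (a ⊗ₜ b * u) = a * convR u * antipodeLin b := by
      intro u
      induction u using TensorProduct.induction_on with
      | zero => simp
      | add u v hu hv => rw [mul_add, map_add, map_add, hu, hv, mul_add, add_mul]
      | tmul c d =>
        rw [Algebra.TensorProduct.tmul_mul_tmul, convR_tmul, convR_tmul, antipodeLin_mul]
        simp only [mul_assoc]
    rw [key, hu, convR_tmul, ← Algebra.commutes, Algebra.smul_def, mul_assoc]

theorem convL_comul (h : H1) : convL (comulHom h) = algebraMap ℂ H1 (counitHom h) := by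
  let P : Subalgebra ℂ H1 :=
    { carrier := {h | convL (comulHom h) = algebraMap ℂ H1 (counitHom h)}
      mul_mem' := by
        intro a b ha hb
        simp only [Set.mem_ofPred_eq] at ha hb ⊢
        rw [map_mul, convL_mul _ _ ha, hb, map_mul, map_mul, Algebra.smul_def]
      add_mem' := by
        intro a b ha hb
        simp only [Set.mem_ofPred_eq] at ha hb ⊢
        rw [map_add, map_add, ha, hb, map_add, map_add]
      algebraMap_mem' := by
        intro r
        simp only [Set.mem_ofPred_eq, AlgHom.commutes, Algebra.TensorProduct.algebraMap_apply,
          convL_tmul, mul_one]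
        simp [Algebra.algebraMap_eq_smul_one, antipodeLin_one] }
  refine mem_of_gen P ?_ ?_ ?_ h
  · change convL (comulHom X) = _
    simp [comulHom_X, convL_tmul, antipodeLin_X, antipodeLin_one, antipodeLin_delta_one,
      counitHom_X]
  · change convL (comulHom Y) = _
    simp [comulHom_Y, convL_tmul, antipodeLin_Y, antipodeLin_one, counitHom_Y]
  · change convL (comulHom (delta 1)) = _
    simp [comulHom_delta_one, convL_tmul, antipodeLin_one, antipodeLin_delta_one,
      counitHom_delta]

theorem convR_comul (h : H1) : convR (comulHom h) = algebraMap ℂ H1 (counitHom h) := by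
  let P : Subalgebra ℂ H1 :=
    { carrier := {h | convR (comulHom h) = algebraMap ℂ H1 (counitHom h)}
      mul_mem' := by
        intro a b ha hb
        simp only [Set.mem_ofPred_eq] at ha hb ⊢
        rw [map_mul, convR_mul _ _ hb, ha, map_mul, map_mul, Algebra.smul_def, Algebra.commutes]
      add_mem' := by
        intro a b ha hb
        simp only [Set.mem_ofPred_eq] at ha hb ⊢
        rw [map_add, map_add, ha, hb, map_add, map_add]
      algebraMap_mem' := by
        intro r
        simp only [Set.mem_ofPred_eq, AlgHom.commutes, Algebra.TensorProduct.algebraMap_apply,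
          convR_tmul, antipodeLin_one, mul_one]
        rfl }
  refine mem_of_gen P ?_ ?_ ?_ h
  · change convR (comulHom X) = _
    simp [comulHom_X, convR_tmul, antipodeLin_X, antipodeLin_Y, antipodeLin_one, counitHom_X]
  · change convR (comulHom Y) = _
    simp [comulHom_Y, convR_tmul, antipodeLin_Y, antipodeLin_one, counitHom_Y]
  · change convR (comulHom (delta 1)) = _
    simp [comulHom_delta_one, convR_tmul, antipodeLin_one, antipodeLin_delta_one,
      counitHom_delta]

instance : HopfAlgebra ℂ H1 where
  antipode := antipodeLin
  mul_antipode_rTensor_comul := LinearMap.ext convL_comul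
  mul_antipode_lTensor_comul := LinearMap.ext convR_comul

end H1

/-! ### Modular forms of all levels -/

/-- `Γ(N)` as a subgroup of `GL(2, ℝ)`. -/
abbrev levelGroup (N : ℕ) : Subgroup (GL (Fin 2) ℝ) :=
  (Gamma N).map (Matrix.SpecialLinearGroup.mapGL ℝ)

theorem levelGroup_le {M N : ℕ} (h : M ∣ N) : levelGroup N ≤ levelGroup M := by
  refine Subgroup.map_mono fun x hx => ?_
  rw [Gamma_mem] at hx ⊢
  have key (a b : ℤ) (hab : (a : ZMod N) = b) : (a : ZMod M) = b := by
    rw [← sub_eq_zero, ← Int.cast_sub, ZMod.intCast_zmod_eq_zero_iff_dvd] at hab ⊢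
    exact (Int.natCast_dvd_natCast.mpr h).trans hab
  exact ⟨by simpa using key _ 1 (by simpa using hx.1), by simpa using key _ 0 (by simpa using hx.2.1),
    by simpa using key _ 0 (by simpa using hx.2.2.1), by simpa using key _ 1 (by simpa using hx.2.2.2)⟩

/-- A modular form for a group is one for every subgroup. -/
def restrictForm {Γ Γ' : Subgroup (GL (Fin 2) ℝ)} (h : Γ' ≤ Γ) {k : ℤ} (F : ModularForm Γ k) :
    ModularForm Γ' k where
  toFun := F
  slash_action_eq' γ hγ := F.slash_action_eq' γ (h hγ)
  holo' := F.holo'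
  bdd_at_cusps' hc := F.bdd_at_cusps' (hc.mono h)

/-- `ℳ_k`: the modular forms of weight `k` and arbitrary level `Γ(N)`, `N ≥ 1`, as functions on
the upper half-plane. -/
def formsOfWeight (k : ℕ) : Submodule ℂ (ℍ → ℂ) where
  carrier := {f | ∃ N : ℕ, N ≠ 0 ∧ ∃ F : ModularForm (levelGroup N) (k : ℤ), ⇑F = f}
  zero_mem' := ⟨1, one_ne_zero, 0, rfl⟩
  add_mem' := by
    rintro _ _ ⟨M, hM, F, rfl⟩ ⟨N, hN, G, rfl⟩
    exact ⟨M * N, mul_ne_zero hM hN, restrictForm (levelGroup_le (dvd_mul_right M N)) F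
      + restrictForm (levelGroup_le (dvd_mul_left N M)) G, rfl⟩
  smul_mem' := by
    rintro c _ ⟨N, hN, F, rfl⟩
    exact ⟨N, hN, c • F, rfl⟩

instance : SetLike.GradedMonoid formsOfWeight where
  one_mem := ⟨1, one_ne_zero, ModularForm.const 1, rfl⟩
  mul_mem := by
    rintro i j _ _ ⟨M, hM, F, rfl⟩ ⟨N, hN, G, rfl⟩
    refine ⟨M * N, mul_ne_zero hM hN, ModularForm.mcast (by push_cast; rfl)
      ((restrictForm (levelGroup_le (dvd_mul_right M N)) F).mul
        (restrictForm (levelGroup_le (dvd_mul_left N M)) G)), rfl⟩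

/-- The graded algebra `ℳ = ⨁_k ℳ_k` of modular forms of all levels. -/
abbrev Forms : Type := ⨁ k : ℕ, formsOfWeight k

/-! ### The slash action of `G⁺(ℚ)` -/

/-- `G⁺(ℚ) = GL⁺(2, ℚ)`. -/
abbrev GPlus : Type := GL(2, ℚ)⁺

/-- The inclusion `G⁺(ℚ) → GL(2, ℝ)`. -/
def toReal : GPlus →* GL (Fin 2) ℝ :=
  (Matrix.GeneralLinearGroup.map (Rat.castHom ℝ)).comp (Matrix.GLPos (Fin 2) ℚ).subtype

theorem toReal_det_pos (γ : GPlus) : 0 < (toReal γ).det.val := by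
  have h : 0 < ((γ : GL (Fin 2) ℚ).det : ℚ) := γ.2
  have e : (toReal γ).det.val = (((γ : GL (Fin 2) ℚ).det : ℚ) : ℝ) := by
    simp only [toReal, MonoidHom.comp_apply, Subgroup.coe_subtype,
      Matrix.GeneralLinearGroup.map_det]
    rfl
  rw [e]; exact_mod_cast h

/-- The weight `k` slash operator
`(f|_k γ)(z) = det(γ)^{k/2} f(γ z) (c z + d)^{-k}`. -/
def slash (k : ℕ) (γ : GPlus) (f : ℍ → ℂ) (z : ℍ) : ℂ :=
  (((toReal γ).det.val ^ ((k : ℝ) / 2) : ℝ) : ℂ) * f (toReal γ • z)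
    * denom (toReal γ) z ^ (-(k : ℤ))

theorem slash_eq (k : ℕ) (γ : GPlus) (f : ℍ → ℂ) :
    slash k γ f = (((toReal γ).det.val ^ ((k : ℝ) / 2) * (toReal γ).det.val ^ (1 - (k : ℤ)) : ℝ) : ℂ)
      • (f ∣[(k : ℤ)] toReal γ) := by
  have hd := toReal_det_pos γ
  ext z
  have e : ((toReal γ).det.val : ℂ) ^ (1 - (k : ℤ)) * ((toReal γ).det.val : ℂ) ^ ((k : ℤ) - 1)
      = 1 := by
    rw [← zpow_add₀ (by exact_mod_cast hd.ne')]; simp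
  simp only [slash, Pi.smul_apply, ModularForm.slash_apply, smul_eq_mul, abs_of_pos hd, σ,
    if_pos hd]
  push_cast
  simp only [ContinuousAlgEquiv.refl_apply]
  linear_combination (-(((toReal γ).det.val ^ ((k : ℝ) / 2) : ℝ) : ℂ) * f (toReal γ • z)
    * denom (toReal γ) z ^ (-(k : ℤ))) * e

theorem slash_mem (k : ℕ) (γ : GPlus) {f : ℍ → ℂ} (hf : f ∈ formsOfWeight k) :
    slash k γ f ∈ formsOfWeight k := by
  obtain ⟨M, hM, F, rfl⟩ := hf
  rw [slash_eq]
  refine Submodule.smul_mem _ _ ?_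
  have : NeZero M := ⟨hM⟩
  obtain ⟨N, hN, h⟩ := exists_Gamma_le_conj' (γ : GL (Fin 2) ℚ) M
  refine ⟨N, hN, restrictForm ?_ (ModularForm.translate F (toReal γ)), rfl⟩
  intro x hx
  rw [ConjAct.toConjAct_inv, Subgroup.mem_inv_pointwise_smul_iff]
  exact h (Subgroup.smul_mem_pointwise_smul x _ _ hx)

/-- The slash operator on `ℳ_k`. -/
def slashForm (k : ℕ) (γ : GPlus) : formsOfWeight k →ₗ[ℂ] formsOfWeight k where
  toFun f := ⟨slash k γ f, slash_mem k γ f.2⟩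
  map_add' f g := Subtype.ext (funext fun z => by
    simp only [slash, Submodule.coe_add, Pi.add_apply]; ring)
  map_smul' c f := Subtype.ext (funext fun z => by
    simp only [slash, Submodule.coe_smul, Pi.smul_apply, smul_eq_mul, RingHom.id_apply]; ring)

theorem slash_zero_one (γ : GPlus) : slash 0 γ 1 = 1 := by
  ext z; simp [slash]

theorem slash_mul_forms (i j : ℕ) (γ : GPlus) (f g : ℍ → ℂ) :
    slash (i + j) γ (f * g) = slash i γ f * slash j γ g := by
  ext z
  have h1 : (toReal γ).det.val ^ (((i + j : ℕ) : ℝ) / 2)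
      = (toReal γ).det.val ^ ((i : ℝ) / 2) * (toReal γ).det.val ^ ((j : ℝ) / 2) := by
    rw [← Real.rpow_add (toReal_det_pos γ)]; push_cast; ring_nf
  have h2 : denom (toReal γ) z ^ (-((i + j : ℕ) : ℤ))
      = denom (toReal γ) z ^ (-(i : ℤ)) * denom (toReal γ) z ^ (-(j : ℤ)) := by
    rw [← zpow_add₀ (denom_ne_zero _ z)]; push_cast; ring_nf
  simp only [slash, Pi.mul_apply]
  rw [h1, h2, Complex.ofReal_mul]
  ring

theorem slash_one (k : ℕ) (f : ℍ → ℂ) : slash k 1 f = f := by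
  ext z; simp [slash, denom]

theorem slash_mul (k : ℕ) (α β : GPlus) (f : ℍ → ℂ) :
    slash k (α * β) f = slash k β (slash k α f) := by
  ext z
  have h1 : (toReal (α * β)).det.val ^ ((k : ℝ) / 2)
      = (toReal α).det.val ^ ((k : ℝ) / 2) * (toReal β).det.val ^ ((k : ℝ) / 2) := by
    rw [← Real.mul_rpow (toReal_det_pos α).le (toReal_det_pos β).le]; simp
  have h2 : denom (toReal (α * β)) z = denom (toReal α) ↑(toReal β • z) * denom (toReal β) z := by
    rw [map_mul, denom_cocycle_σ]
    simp only [σ, if_pos (toReal_det_pos β), ContinuousAlgEquiv.refl_apply]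
  simp only [slash]
  rw [h1, h2, mul_zpow, map_mul, mul_smul, Complex.ofReal_mul]
  ring

/-- The action of `γ` on `ℳ`: `f ↦ f|_k γ` on `ℳ_k`. It is an algebra endomorphism. -/
def slashHom (γ : GPlus) : Forms →ₐ[ℂ] Forms :=
  DirectSum.toAlgebra ℂ (fun k => formsOfWeight k)
    (fun k => DirectSum.lof ℂ ℕ (fun k => formsOfWeight k) k ∘ₗ slashForm k γ)
    (by
      change DirectSum.of (fun k => formsOfWeight k) 0 (slashForm 0 γ _) = 1
      rw [DirectSum.one_def]
      exact congrArg _ (Subtype.ext (slash_zero_one γ)))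
    (by
      intro i j f g
      change DirectSum.of (fun k => formsOfWeight k) (i + j) (slashForm (i + j) γ _)
        = DirectSum.of (fun k => formsOfWeight k) i (slashForm i γ f)
          * DirectSum.of (fun k => formsOfWeight k) j (slashForm j γ g)
      rw [DirectSum.of_mul_of]
      exact congrArg _ (Subtype.ext (slash_mul_forms i j γ f g)))

theorem slashHom_of (γ : GPlus) (k : ℕ) (f : formsOfWeight k) :
    slashHom γ (DirectSum.of (fun k => formsOfWeight k) k f)
      = DirectSum.of (fun k => formsOfWeight k) k (slashForm k γ f) :=
  DirectSum.toAddMonoid_of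
    (fun k => (DirectSum.lof ℂ ℕ (fun k => formsOfWeight k) k ∘ₗ slashForm k γ).toAddMonoidHom) k f

theorem forms_hom_ext {B : Type*} [Semiring B] [Algebra ℂ B] {φ ψ : Forms →ₐ[ℂ] B}
    (h : ∀ k f, φ (DirectSum.of (fun k => formsOfWeight k) k f)
      = ψ (DirectSum.of (fun k => formsOfWeight k) k f)) : φ = ψ :=
  DirectSum.algHom_ext' ℂ _ fun k => LinearMap.ext (h k)

theorem slashHom_one : slashHom 1 = AlgHom.id ℂ Forms :=
  forms_hom_ext fun k f => by
    rw [slashHom_of]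
    exact congrArg _ (Subtype.ext (slash_one k f))

theorem slashHom_mul (α β : GPlus) : slashHom (α * β) = (slashHom β).comp (slashHom α) :=
  forms_hom_ext fun k f => by
    rw [AlgHom.comp_apply, slashHom_of, slashHom_of, slashHom_of]
    exact congrArg _ (Subtype.ext (slash_mul k α β f))

/-- The right action of `G⁺(ℚ)` on `ℳ` as an action of the opposite group. -/
instance : MulSemiringAction GPlusᵐᵒᵖ Forms where
  smul γ f := slashHom γ.unop f
  one_smul f := DFunLike.congr_fun slashHom_one f
  mul_smul α β f := DFunLike.congr_fun (slashHom_mul β.unop α.unop) f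
  smul_zero γ := map_zero (slashHom γ.unop)
  smul_add γ := map_add (slashHom γ.unop)
  smul_one γ := map_one (slashHom γ.unop)
  smul_mul γ := map_mul (slashHom γ.unop)

instance : SMulCommClass GPlusᵐᵒᵖ ℂ Forms where
  smul_comm γ c f := map_smul (slashHom γ.unop) c f

/-! ### The crossed product -/

/-- The crossed product `𝒜 = ℳ ⋊ G⁺(ℚ)`. -/
abbrev Crossed : Type := SkewMonoidAlgebra Forms GPlusᵐᵒᵖ

/-- The element `f U_γ^*` of `𝒜`, for `f ∈ ℳ_k`. -/
def symb {k : ℕ} (f : formsOfWeight k) (γ : GPlus) : Crossed :=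
  SkewMonoidAlgebra.single (MulOpposite.op γ) (DirectSum.of (fun k => formsOfWeight k) k f)

/-- The product rule `f U_α^* · g U_β^* = (f · g|α) U_{βα}^*`. -/
theorem symb_mul {k l : ℕ} (f : formsOfWeight k) (g : formsOfWeight l) (α β : GPlus) :
    symb f α * symb g β = symb (k := k + l)
      ⟨f * slash l α g, SetLike.mul_mem_graded f.2 (slash_mem l α g.2)⟩ (β * α) := by
  rw [symb, symb, SkewMonoidAlgebra.single_mul_single]
  change SkewMonoidAlgebra.single _ (_ * slashHom α _) = _
  rw [slashHom_of, DirectSum.of_mul_of]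
  rfl

/-! ### The action of `ℋ₁` on the crossed product -/

/-- `ρ` is a Hopf action (it makes `𝒜` an `ℋ₁`-module algebra):
`h(ab) = ∑ h₍₁₎(a) h₍₂₎(b)` and `h(1) = ε(h) 1`. -/
structure IsHopfAction (ρ : H1 →ₐ[ℂ] Module.End ℂ Crossed) : Prop where
  map_mul : ∀ (h : H1) (a b : Crossed),
    ρ h (a * b) = TensorProduct.lift
      ((LinearMap.mul ℂ Crossed).compl₁₂ (ρ.toLinearMap.flip a) (ρ.toLinearMap.flip b))
      (Coalgebra.comul (R := ℂ) h)
  map_one : ∀ h : H1, ρ h 1 = Coalgebra.counit (R := ℂ) h • (1 : Crossed)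

/-- `η⁴` on the upper half-plane. -/
def etaFour (z : ℍ) : ℂ := η (z : ℂ) ^ 4

/-- The derivation `X = (1/2πi) d/dz - (1/2πi) (d/dz log η⁴) · Y` on forms of weight `k`, where
`Y f = (k/2) f`. Here `D = (1/2πi) d/dz`. -/
def ramanujan (k : ℕ) (f : ℍ → ℂ) (z : ℍ) : ℂ :=
  D f z - D etaFour z / etaFour z * ((k : ℂ) / 2 * f z)

/-- `μ_γ = (1/2πi) d/dz log ((η⁴|_2 γ) / η⁴)`. -/
def mu (γ : GPlus) (z : ℍ) : ℂ :=
  D (slash 2 γ etaFour / etaFour) z / (slash 2 γ etaFour / etaFour) z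

/-- `ρ` is the Hopf action of `ℋ₁` on `𝒜` determined by `X(f U_γ^*) = X(f) U_γ^*`,
`Y(f U_γ^*) = Y(f) U_γ^*` and `δ₁(f U_γ^*) = μ_γ f U_γ^*`. -/
structure IsModularAction (ρ : H1 →ₐ[ℂ] Module.End ℂ Crossed) : Prop where
  hopf : IsHopfAction ρ
  X_apply : ∀ (k : ℕ) (f : formsOfWeight k) (γ : GPlus), ∃ g : formsOfWeight (k + 2),
    (g : ℍ → ℂ) = ramanujan k f ∧ ρ H1.X (symb f γ) = symb g γ
  Y_apply : ∀ (k : ℕ) (f : formsOfWeight k) (γ : GPlus),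
    ρ H1.Y (symb f γ) = symb (((k : ℂ) / 2) • f) γ
  delta_one_apply : ∀ (k : ℕ) (f : formsOfWeight k) (γ : GPlus), ∃ g : formsOfWeight (k + 2),
    (g : ℍ → ℂ) = mu γ * f ∧ ρ (H1.delta 1) (symb f γ) = symb g γ

/-! ### The coordinate `Z` -/

/-- `Z(z) = (2πi/6) ∫_{i∞}^z η⁴ dw`, the integral being taken along the vertical ray
`w = z + it`, with `t` going from `∞` to `0`. -/
def eichlerZ (z : ℍ) : ℂ :=
  2 * Real.pi * Complex.I / 6 *
    -∫ t in Set.Ioi (0 : ℝ), η ((z : ℂ) + t * Complex.I) ^ 4 * Complex.I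

/-- The operator `d/dZ` on functions on the upper half-plane. -/
def ddZ (F : ℍ → ℂ) (z : ℍ) : ℂ :=
  deriv (F ∘ ofComplex) z / deriv (eichlerZ ∘ ofComplex) z

/-- `L` is a holomorphic branch on the upper half-plane of `log (d(Z|_0 γ)/dZ)`. -/
structure IsLogJacobian (γ : GPlus) (L : ℍ → ℂ) : Prop where
  holo : MDiff L
  exp_eq : ∀ z : ℍ, Complex.exp (L z) = ddZ (slash 0 γ eichlerZ) z

/-- The higher differential `F · (dZ)^n` as a function of weight `2n`: its coefficient with respect
to `(2πi dz)^n`. The coefficient of the `1`-form `dZ` with respect to `2πi dz` is `D Z`. -/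
def higherDiff (n : ℕ) (F : ℍ → ℂ) (z : ℍ) : ℂ := F z * D eichlerZ z ^ n

end ModularHecke

end

noncomputable section

namespace ModularHecke

open UpperHalfPlane hiding I
open ModularForm CongruenceSubgroup Derivative
open scoped TensorProduct MatrixGroups DirectSum Manifold ModularForm

/-! ### Derivatives and the slash operator -/

/-! Since D log η⁴ = E₂/6, the operator X is the Serre derivative f ↦ Df − (k/12) E₂ f, which
preserves modularity. D commutes with the weight k slash only up to a multiple of c/(cz+d), and
subtracting the E₂ term turns this defect into a modular one: X(f|γ) = X(f)|γ + μ_γ · Y(f)|γ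
(`ramanujan_slash`), with the cocycle rule μ_{αβ} = μ_α|β + μ_β (`mu_mul`). These two identities are
the Leibniz rules that ΔX and Δδ₁ demand on monomials of the crossed product.

That μ_γ lies in ℳ₂ (`mu_mem`) also rests on the cocycle rule. Quasi-modularity of E₂ gives μ = 0 on
SL(2, ℤ). Hence μ_γ is invariant under any Γ(N) that γ conjugates into SL(2, ℤ), and its growth at
the cusps need only be checked for upper triangular matrices.

For existence, δ_n acts on the coefficient of U_γ^* as multiplication by X^{n-1} μ_γ. The brackets
hold because X and Y are derivations of ℳ with [Y, X] = X and multiplication operators commute. The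
Hopf conditions pass from X, Y, δ₁ to everything they generate, and so does uniqueness.

For the formula, DZ = η⁴/6, so the Jacobian d(Z|γ)/dZ is (η⁴|₂γ)/η⁴. It has no zeros, hence has a
logarithm L, and DL = μ_γ: this is n = 1. As X kills η⁴, it kills DZ, so X sends F (dZ)^n to
(dF/dZ)(dZ)^{n+1} (`ramanujan_higherDiff`). The relation δ_{n+1} = [X, δ_n] then yields all n by
induction. -/

theorem slash_mdifferentiable (k : ℕ) (γ : GPlus) {F : ℍ → ℂ} (hF : MDiff F) :
    MDiff (slash k γ F) := by
  have h1 : MDiff (fun z : ℍ => F (toReal γ • z)) :=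
    hF.comp (mdifferentiable_smul (toReal_det_pos γ))
  exact (mdifferentiable_const.mul h1).mul (mdifferentiable_denom_zpow (toReal γ) _)

theorem slash_ne_zero (k : ℕ) (γ : GPlus) {F : ℍ → ℂ} (hF : ∀ z, F z ≠ 0) (z : ℍ) :
    slash k γ F z ≠ 0 := by
  have hd := toReal_det_pos γ
  refine mul_ne_zero (mul_ne_zero ?_ (hF _)) (zpow_ne_zero _ (denom_ne_zero _ z))
  exact_mod_cast (Real.rpow_pos_of_pos hd _).ne'

theorem slash_add (k : ℕ) (γ : GPlus) (f g : ℍ → ℂ) :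
    slash k γ (f + g) = slash k γ f + slash k γ g := by
  ext z; simp only [slash, Pi.add_apply]; ring

theorem slash_sub (k : ℕ) (γ : GPlus) (f g : ℍ → ℂ) :
    slash k γ (f - g) = slash k γ f - slash k γ g := by
  ext z; simp only [slash, Pi.sub_apply]; ring

theorem slash_smul (k : ℕ) (γ : GPlus) (c : ℂ) (f : ℍ → ℂ) :
    slash k γ (c • f) = c • slash k γ f := by
  ext z; simp only [slash, Pi.smul_apply, smul_eq_mul]; ring

/-- The failure of `D` to commute with the slash operators is governed by `c / (c z + d)`. -/
def autRatio (γ : GPlus) (z : ℍ) : ℂ :=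
  (2 * Real.pi * Complex.I)⁻¹ * ((toReal γ 1 0 : ℝ) / denom (toReal γ) z)

/-- The chain rule for Mathlib's slash, transferred to the normalisation det^{k/2} through
`slash_eq`. -/
theorem D_slash (k : ℕ) (γ : GPlus) {F : ℍ → ℂ} (hF : MDiff F) :
    D (slash k γ F) = slash (k + 2) γ (D F) - (k : ℂ) • (autRatio γ * slash k γ F) := by
  have hd := toReal_det_pos γ
  have hdet : (toReal γ).val.det = (toReal γ).det.val := rfl
  have hs : MDiff (F ∣[(k : ℤ)] toReal γ) := hF.slash _ _
  -- Passing from weight k to k + 2 multiplies the scalar between the two normalisations by det ·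
  -- det⁻², which is the factor det⁻¹ in the chain rule for Mathlib's slash.
  have hC : (((toReal γ).det.val ^ (((k + 2 : ℕ) : ℝ) / 2)
        * (toReal γ).det.val ^ (1 - ((k + 2 : ℕ) : ℤ)) : ℝ) : ℂ)
      = (((toReal γ).det.val ^ ((k : ℝ) / 2) * (toReal γ).det.val ^ (1 - (k : ℤ)) : ℝ) : ℂ)
        * ((toReal γ).det.val : ℂ)⁻¹ := by
    have e1 : (toReal γ).det.val ^ (((k + 2 : ℕ) : ℝ) / 2)
        = (toReal γ).det.val ^ ((k : ℝ) / 2) * (toReal γ).det.val := by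
      rw [show ((k + 2 : ℕ) : ℝ) / 2 = (k : ℝ) / 2 + 1 by push_cast; ring, Real.rpow_add hd,
        Real.rpow_one]
    have e2 : (toReal γ).det.val ^ (1 - ((k + 2 : ℕ) : ℤ))
        = (toReal γ).det.val ^ (1 - (k : ℤ)) * ((toReal γ).det.val ^ 2)⁻¹ := by
      rw [show (1 - ((k + 2 : ℕ) : ℤ)) = (1 - (k : ℤ)) + (-2) by push_cast; ring,
        zpow_add₀ hd.ne', zpow_neg]
      norm_cast
    rw [e1, e2]
    push_cast
    have : ((toReal γ).det.val : ℂ) ≠ 0 := by exact_mod_cast hd.ne'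
    field_simp
  rw [slash_eq, normalizedDerivOfComplex_smul _ _ hs, slash_eq, hC,
    normalizedDerivOfComplex_slash hF (by rw [hdet]; exact hd)]
  ext z
  simp only [Pi.smul_apply, Pi.sub_apply, Pi.mul_apply, smul_eq_mul, autRatio, hdet]
  push_cast
  ring

/-! ### The logarithmic derivative of `η⁴` -/

theorem etaFour_mdifferentiable : MDiff etaFour := by
  rw [UpperHalfPlane.mdifferentiable_iff]
  refine DifferentiableOn.congr (f := fun z => η z ^ 4) (fun z hz => ?_) (fun z hz => ?_)
  · exact ((differentiableAt_eta_of_mem_upperHalfPlaneSet hz).pow 4).differentiableWithinAt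
  · simp [etaFour, ofComplex_apply_of_im_pos hz]

theorem etaFour_ne_zero (z : ℍ) : etaFour z ≠ 0 := pow_ne_zero 4 (eta_ne_zero z.2)

theorem deriv_comp_ofComplex_eq {F : ℍ → ℂ} {f : ℂ → ℂ} (h : ∀ z : ℍ, F z = f z) (z : ℍ) :
    deriv (F ∘ ofComplex) z = deriv f z := by
  refine Filter.EventuallyEq.deriv_eq ?_
  filter_upwards [isOpen_upperHalfPlaneSet.mem_nhds z.im_pos] with w hw
  simp [ofComplex_apply_of_im_pos hw, h]

theorem D_etaFour_div (z : ℍ) :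
    D etaFour z / etaFour z = 6⁻¹ * EisensteinSeries.E2 z := by
  have h := logDeriv_eta_eq_E2 z
  rw [logDeriv_apply] at h
  have hη : η (z : ℂ) ≠ 0 := eta_ne_zero z.2
  have hE : deriv η (z : ℂ) = Real.pi * Complex.I / 12 * EisensteinSeries.E2 z * η (z : ℂ) := by
    rw [← h]; field_simp
  rw [normalizedDerivOfComplex, deriv_comp_ofComplex_eq (F := etaFour) (f := fun z => η z ^ 4) (fun _ => rfl),
    deriv_fun_pow (differentiableAt_eta_of_mem_upperHalfPlaneSet z.2), hE, etaFour]
  have hpi : (Real.pi : ℂ) ≠ 0 := by exact_mod_cast Real.pi_ne_zero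
  field_simp
  norm_num
  ring

theorem D_etaFour : D etaFour = (6⁻¹ : ℂ) • (EisensteinSeries.E2 * etaFour) := by
  ext z
  have := D_etaFour_div z
  rw [div_eq_iff (etaFour_ne_zero z)] at this
  simp [this, mul_assoc]

/-- The correction term is (E₂/6)(k/2) = (k/12) E₂, so the theory of the Serre derivative applies to
X. -/
theorem ramanujan_eq_serreDerivative (k : ℕ) (f : ℍ → ℂ) :
    ramanujan k f = serreDerivative k f := by
  ext z
  rw [ramanujan, D_etaFour_div, serreDerivative_apply]
  ring

theorem D_div {F G : ℍ → ℂ} (hF : MDiff F) (hG : MDiff G) (hG0 : ∀ z, G z ≠ 0) (z : ℍ) :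
    D (F / G) z = (D F z * G z - F z * D G z) / G z ^ 2 := by
  have hFz := UpperHalfPlane.mdifferentiableAt_iff.mp (hF z)
  have hGz := UpperHalfPlane.mdifferentiableAt_iff.mp (hG z)
  have h0 : (G ∘ ofComplex) (z : ℂ) ≠ 0 := by simpa [ofComplex_apply] using hG0 z
  simp only [normalizedDerivOfComplex]
  rw [show (F / G) ∘ ofComplex = (F ∘ ofComplex) / (G ∘ ofComplex) from rfl,
    deriv_div hFz hGz h0]
  simp only [Function.comp_apply, ofComplex_apply]
  ring

theorem mu_eq_sub (γ : GPlus) (z : ℍ) :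
    mu γ z = D (slash 2 γ etaFour) z / slash 2 γ etaFour z - D etaFour z / etaFour z := by
  have h1 := slash_ne_zero 2 γ etaFour_ne_zero z
  have h2 := etaFour_ne_zero z
  rw [mu, D_div (slash_mdifferentiable 2 γ etaFour_mdifferentiable) etaFour_mdifferentiable
    etaFour_ne_zero, Pi.div_apply]
  field_simp

/-- The defect −2 `autRatio γ` does not depend on G, so it cancels when two such logarithmic
derivatives are compared. It is used for G = η⁴ and for G = η⁴|α. -/
theorem D_slash_two_div (γ : GPlus) {G : ℍ → ℂ} (hG : MDiff G) (hG0 : ∀ z, G z ≠ 0) (z : ℍ) :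
    D (slash 2 γ G) z / slash 2 γ G z = slash 2 γ (D G / G) z - 2 * autRatio γ z := by
  have h1 := slash_ne_zero 2 γ hG0 z
  have e : slash 4 γ (D G) = slash 2 γ (D G / G) * slash 2 γ G := by
    rw [← slash_mul_forms 2 2]
    congr 1
    ext w
    simp [hG0 w]
  rw [D_slash 2 γ hG, e]
  simp only [Pi.sub_apply, Pi.mul_apply, Pi.smul_apply, smul_eq_mul]
  field_simp
  push_cast
  ring

/-- This presents μ_γ as the defect of E₂/6 from weight 2 invariance, corrected by the automorphy
term. Holomorphy, vanishing on SL(2, ℤ) and growth at i∞ are all read off from this form. -/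
theorem mu_eq (γ : GPlus) :
    mu γ = (6⁻¹ : ℂ) • (slash 2 γ EisensteinSeries.E2 - EisensteinSeries.E2)
      - (2 : ℂ) • autRatio γ := by
  have e : D etaFour / etaFour = (6⁻¹ : ℂ) • EisensteinSeries.E2 := by
    ext w; simpa using D_etaFour_div w
  ext z
  rw [mu_eq_sub, D_slash_two_div γ etaFour_mdifferentiable etaFour_ne_zero, e, slash_smul,
    D_etaFour_div]
  simp only [Pi.sub_apply, Pi.smul_apply, smul_eq_mul]
  ring

theorem autRatio_mdifferentiable (γ : GPlus) : MDiff (autRatio γ) :=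
  mdifferentiable_const.mul (mdifferentiable_const.mul (mdifferentiable_inv_denom (toReal γ)))

theorem mu_mdifferentiable (γ : GPlus) : MDiff (mu γ) := by
  rw [mu_eq]
  exact (((slash_mdifferentiable 2 γ E2_mdifferentiable).sub E2_mdifferentiable).const_smul _).sub
    ((autRatio_mdifferentiable γ).const_smul _)

/-- The cocycle relation. -/
theorem mu_mul (α β : GPlus) : mu (α * β) = slash 2 β (mu α) + mu β := by
  have hα := slash_mdifferentiable 2 α etaFour_mdifferentiable
  have hα0 := slash_ne_zero 2 α etaFour_ne_zero
  -- Slashing D log(η⁴|α) = μ_α + D log η⁴ by β gives the cocycle relation; the `autRatio β` terms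
  -- on the two sides cancel.
  have e : D (slash 2 α etaFour) / slash 2 α etaFour = mu α + D etaFour / etaFour := by
    ext w; simp [mu_eq_sub]
  ext z
  rw [mu_eq_sub, slash_mul, D_slash_two_div β hα hα0, e, slash_add, Pi.add_apply, Pi.add_apply,
    mu_eq_sub β, D_slash_two_div β etaFour_mdifferentiable etaFour_ne_zero]
  ring

theorem mu_one : mu 1 = 0 := by
  have h := mu_mul 1 1
  rw [mul_one, slash_one] at h
  simpa using h

/-- The derivation `X` commutes with the slash operators up to the cocycle `μ`. -/
theorem ramanujan_slash (k : ℕ) (γ : GPlus) {f : ℍ → ℂ} (hf : MDiff f) :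
    ramanujan k (slash k γ f)
      = slash (k + 2) γ (ramanujan k f) + mu γ * (((k : ℂ) / 2) • slash k γ f) := by
  -- By `mu_eq`, E₂|γ = E₂ + 6 μ_γ + 12 `autRatio γ`; the last term cancels the one in `D_slash`,
  -- and the middle one leaves (k/2) μ_γ.
  have e : ramanujan k f = D f - ((k : ℂ) / 12) • (f * EisensteinSeries.E2) := by
    ext z; simp [ramanujan_eq_serreDerivative]; ring
  rw [e, slash_sub, slash_smul, slash_mul_forms, mu_eq]
  ext z
  simp only [ramanujan_eq_serreDerivative, serreDerivative_apply, D_slash k γ hf, Pi.sub_apply,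
    Pi.add_apply, Pi.mul_apply, Pi.smul_apply, smul_eq_mul]
  ring

theorem ramanujan_mul (i j : ℕ) {f g : ℍ → ℂ} (hf : MDiff f) (hg : MDiff g) :
    ramanujan (i + j) (f * g) = ramanujan i f * g + f * ramanujan j g := by
  simp only [ramanujan_eq_serreDerivative, Nat.cast_add]
  exact serreDerivative_mul i j f g hf hg

/-! ### `X` and `μ` preserve modularity -/

/-- Cauchy's estimate on discs of radius 1. -/
theorem isBoundedAtImInfty_D {F : ℍ → ℂ} (hF : MDiff F) (hb : IsBoundedAtImInfty F) :
    IsBoundedAtImInfty (D F) := by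
  rw [isBoundedAtImInfty_iff] at hb ⊢
  obtain ⟨M, A, h⟩ := hb
  -- From this height on, the closed unit disc around z lies in ℍ and in the region where M bounds
  -- F.
  refine ⟨‖(2 * Real.pi * Complex.I : ℂ)⁻¹‖ * M, max A 0 + 2, fun z hz => ?_⟩
  have him : ∀ w ∈ Metric.closedBall (z : ℂ) 1, max A 0 + 1 ≤ w.im := by
    intro w hw
    have h1 : |(w - z).im| ≤ 1 :=
      (Complex.abs_im_le_norm _).trans (by simpa [dist_eq_norm] using hw)
    have h2 : -1 ≤ (w - z).im := (abs_le.mp h1).1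
    have h3 : (z : ℂ).im = z.im := rfl
    rw [Complex.sub_im, h3] at h2
    linarith
  have hpos : ∀ w ∈ Metric.closedBall (z : ℂ) 1, 0 < w.im := fun w hw => by
    linarith [him w hw, le_max_right A 0]
  have hd : DifferentiableOn ℂ (F ∘ ofComplex) (Metric.closedBall (z : ℂ) 1) :=
    (UpperHalfPlane.mdifferentiable_iff.mp hF).mono hpos
  have key := Complex.norm_deriv_le_of_forall_mem_sphere_norm_le (c := (z : ℂ)) (R := 1) (C := M)
    (f := F ∘ ofComplex) one_pos (hd.diffContOnCl_ball subset_rfl) (fun w hw => by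
      have hw' := Metric.sphere_subset_closedBall hw
      rw [Function.comp_apply, ofComplex_apply_of_im_pos (hpos w hw')]
      refine h _ ?_
      change A ≤ w.im
      linarith [him w hw', le_max_left A 0])
  rw [div_one] at key
  rw [normalizedDerivOfComplex, norm_mul]
  gcongr

theorem isBoundedAtImInfty_serreDerivative (k : ℂ) {F : ℍ → ℂ} (hF : MDiff F)
    (hb : IsBoundedAtImInfty F) : IsBoundedAtImInfty (serreDerivative k F) := by
  have e : serreDerivative k F = D F - (k * 12⁻¹) • (EisensteinSeries.E2 * F) := by
    ext z; simp [mul_assoc]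
  rw [e]
  let S := boundedAtImInftySubalgebra ℂ
  exact S.sub_mem (isBoundedAtImInfty_D hF hb)
    (S.smul_mem (S.mul_mem EisensteinSeries.isBoundedAtImInfty_E2 hb) _)

theorem levelGroup_le_SL (N : ℕ) : levelGroup N ≤ 𝒮ℒ := by
  rintro _ ⟨s, -, rfl⟩
  exact ⟨s, rfl⟩

/-- The derivation `X` on modular forms of level `N`. -/
def ramanujanForm {N k : ℕ} (F : ModularForm (levelGroup N) (k : ℤ)) :
    ModularForm (levelGroup N) ((k + 2 : ℕ) : ℤ) where
  toFun := serreDerivative ((k : ℤ) : ℂ) F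
  slash_action_eq' := by
    rintro _ ⟨s, hs, rfl⟩
    have h : (F : ℍ → ℂ) ∣[(k : ℤ)] s = F := F.slash_action_eq' _ ⟨s, hs, rfl⟩
    have e : ((k + 2 : ℕ) : ℤ) = (k : ℤ) + 2 := by push_cast; rfl
    rw [e]
    exact serreDerivative_slash_invariant F.holo' h
  holo' := serreDerivative_mdifferentiable _ F.holo'
  bdd_at_cusps' := by
    intro c hc
    have hc' := hc.mono (levelGroup_le_SL N)
    -- Boundedness at a cusp is tested at i∞ on SL(2, ℤ)-translates, with which the Serre derivative
    -- commutes.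
    rw [OnePoint.isBoundedAt_iff_forall_SL2Z hc']
    intro s hs
    have hb := (OnePoint.isBoundedAt_iff_forall_SL2Z hc').mp (F.bdd_at_cusps' hc) s hs
    have hd : MDiff ((F : ℍ → ℂ) ∣[(k : ℤ)] s) := F.holo'.slash _ _
    have e : ((k + 2 : ℕ) : ℤ) = (k : ℤ) + 2 := by push_cast; rfl
    have hF : MDiff (F : ℍ → ℂ) := F.holo'
    rw [e, serreDerivative_slash_equivariant hF]
    exact isBoundedAtImInfty_serreDerivative _ hd hb

theorem mdifferentiable_of_mem {k : ℕ} {f : ℍ → ℂ} (hf : f ∈ formsOfWeight k) : MDiff f := by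
  obtain ⟨N, -, F, rfl⟩ := hf
  exact F.holo'

theorem ramanujan_mem {k : ℕ} {f : ℍ → ℂ} (hf : f ∈ formsOfWeight k) :
    ramanujan k f ∈ formsOfWeight (k + 2) := by
  obtain ⟨N, hN, F, rfl⟩ := hf
  refine ⟨N, hN, ramanujanForm F, ?_⟩
  rw [ramanujan_eq_serreDerivative]
  exact congrArg (serreDerivative · F) (Int.cast_natCast k)

/-- The inclusion of `SL(2, ℤ)` in `G⁺(ℚ)`. -/
def ofSL : SL(2, ℤ) →* GPlus :=
  Matrix.SpecialLinearGroup.toGLPos.comp (Matrix.SpecialLinearGroup.map (Int.castRingHom ℚ))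

theorem coe_ofSL (s : SL(2, ℤ)) :
    (ofSL s : GL (Fin 2) ℚ) = Matrix.SpecialLinearGroup.mapGL ℚ s := by
  ext i j; rfl

theorem toReal_ofSL (s : SL(2, ℤ)) : toReal (ofSL s) = Matrix.SpecialLinearGroup.mapGL ℝ s := by
  ext i j
  change (((s i j : ℤ) : ℚ) : ℝ) = ((s i j : ℤ) : ℝ)
  simp

theorem slash_ofSL (k : ℕ) (s : SL(2, ℤ)) (f : ℍ → ℂ) :
    slash k (ofSL s) f = f ∣[(k : ℤ)] s := by
  rw [slash_eq, toReal_ofSL]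
  have : (Matrix.SpecialLinearGroup.mapGL ℝ s).det.val = 1 := by simp
  rw [this]
  simp only [Real.one_rpow, one_zpow, mul_one, Complex.ofReal_one, one_smul]
  rfl

/-- Quasi-modularity of E₂: with ζ(2) = π²/6, the difference E₂|s − E₂ is exactly 12 `autRatio`, so
the two terms of `mu_eq` cancel. -/
theorem mu_ofSL (s : SL(2, ℤ)) : mu (ofSL s) = 0 := by
  rw [mu_eq, slash_ofSL]
  ext z
  have h := congrFun (EisensteinSeries.E2_slash_action s) z
  simp only [Pi.sub_apply, Pi.smul_apply, smul_eq_mul, Pi.zero_apply, autRatio, toReal_ofSL,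
    Nat.cast_ofNat] at h ⊢
  rw [h, EisensteinSeries.D2, riemannZeta_two]
  have hpi : (Real.pi : ℂ) ≠ 0 := by exact_mod_cast Real.pi_ne_zero
  have e1 : ((Matrix.SpecialLinearGroup.mapGL ℝ s 1 0 : ℝ) : ℂ) = (s 1 0 : ℂ) := by simp
  have e2 : denom (Matrix.SpecialLinearGroup.mapGL ℝ s) z
      = denom (Matrix.SpecialLinearGroup.toGL
          ((Matrix.SpecialLinearGroup.map (Int.castRingHom ℝ)) s)) z := rfl
  have hz := denom_ne_zero (Matrix.SpecialLinearGroup.toGL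
          ((Matrix.SpecialLinearGroup.map (Int.castRingHom ℝ)) s)) z
  rw [e1, e2]
  field_simp
  ring_nf
  simp

/-- Every element of `G⁺(ℚ)` is the product of an element of `SL(2, ℤ)` and an upper triangular
one. -/
theorem exists_eq_ofSL_mul (γ : GPlus) :
    ∃ (s : SL(2, ℤ)) (τ : GPlus), γ = ofSL s * τ ∧ (τ : GL (Fin 2) ℚ) 1 0 = 0 := by
  -- SL(2, ℤ) is transitive on the rational cusps; if s∞ = γ∞, then s⁻¹γ fixes ∞ and is upper
  -- triangular.
  obtain ⟨s, hs⟩ := OnePoint.exists_mem_SL2 ℤ ((γ : GL (Fin 2) ℚ) • (OnePoint.infty : OnePoint ℚ))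
  refine ⟨s, (ofSL s)⁻¹ * γ, by simp, ?_⟩
  rw [← OnePoint.smul_infty_eq_self_iff]
  rw [Subgroup.coe_mul, Subgroup.coe_inv, coe_ofSL, mul_smul, ← hs, inv_smul_smul]

/-- Write γ = sτ with τ upper triangular. The cocycle rule gives μ_γ = μ_τ, and for c = 0 the
automorphy term vanishes and the slash preserves boundedness at i∞. -/
theorem isBoundedAtImInfty_mu (γ : GPlus) : IsBoundedAtImInfty (mu γ) := by
  obtain ⟨s, τ, rfl, hτ⟩ := exists_eq_ofSL_mul γ
  have h0 : toReal τ 1 0 = 0 := by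
    change (((τ : GL (Fin 2) ℚ) 1 0 : ℚ) : ℝ) = 0
    rw [hτ, Rat.cast_zero]
  have hr : autRatio τ = 0 := by ext z; simp [autRatio, h0]
  have hz : slash 2 τ 0 = 0 := by ext z; simp [slash]
  rw [mu_mul, mu_ofSL, hz, zero_add, mu_eq, hr, smul_zero, sub_zero, slash_eq]
  let S := boundedAtImInftySubalgebra ℂ
  have hE := EisensteinSeries.isBoundedAtImInfty_E2
  exact S.smul_mem (S.sub_mem (S.smul_mem (hE.slash (g := toReal τ) _ h0) _) hE) _

/-- Choose N so that t = γsγ⁻¹ is integral for s in Γ(N). Evaluating μ on tγ = γs by the cocycle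
rule gives μ_γ = μ_γ|s. At the other cusps, μ_γ|s = μ_{γs} is again bounded at i∞. -/
theorem mu_mem (γ : GPlus) : mu γ ∈ formsOfWeight 2 := by
  obtain ⟨N, hN, h⟩ := exists_Gamma_le_conj (γ : GL (Fin 2) ℚ) 1
  have hinv : ∀ A ∈ levelGroup N, mu γ ∣[((2 : ℕ) : ℤ)] A = mu γ := by
    rintro _ ⟨s, hs, rfl⟩
    obtain ⟨t, -, ht⟩ := h s hs
    have e : ofSL t * γ = γ * ofSL s := by
      refine Subtype.ext ?_
      rw [Subgroup.coe_mul, Subgroup.coe_mul, coe_ofSL, coe_ofSL, ht, inv_mul_cancel_right]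
    have hz : slash 2 γ 0 = 0 := by ext z; simp [slash]
    have e2 := congrArg mu e
    rw [mu_mul, mu_mul, mu_ofSL, mu_ofSL, hz, zero_add, add_zero, slash_ofSL] at e2
    exact e2.symm
  have hbdd : ∀ {c}, IsCusp c (levelGroup N) → c.IsBoundedAt (mu γ) ((2 : ℕ) : ℤ) := by
    intro c hc
    rw [OnePoint.isBoundedAt_iff_forall_SL2Z (hc.mono (levelGroup_le_SL N))]
    intro s _
    have e := mu_mul γ (ofSL s)
    rw [mu_ofSL, add_zero, slash_ofSL] at e
    have := isBoundedAtImInfty_mu (γ * ofSL s)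
    rwa [e] at this
  exact ⟨N, hN, ⟨⟨mu γ, hinv⟩, mu_mdifferentiable γ, hbdd⟩, rfl⟩

/-! ### The derivations `X` and `Y` of the algebra of modular forms -/

/-- Weights such as (i + j) + 2 and i + (j + 2) agree only up to a proof, so elements of ℳ are
compared through their underlying functions. -/
theorem of_eq_of {i j : ℕ} (h : i = j) {f : formsOfWeight i} {g : formsOfWeight j}
    (e : (f : ℍ → ℂ) = g) :
    DirectSum.of (fun k => formsOfWeight k) i f = DirectSum.of (fun k => formsOfWeight k) j g := by
  subst h
  rw [Subtype.ext e]

theorem of_add_of {i j l : ℕ} (hi : i = l) (hj : j = l) {f : formsOfWeight i} {g : formsOfWeight j}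
    {h : formsOfWeight l} (e : (f : ℍ → ℂ) + g = h) :
    DirectSum.of (fun k => formsOfWeight k) i f + DirectSum.of (fun k => formsOfWeight k) j g
      = DirectSum.of (fun k => formsOfWeight k) l h := by
  subst hi hj
  rw [← map_add]
  exact of_eq_of rfl e

/-- The derivation `X : ℳ_k → ℳ_{k+2}`. -/
def ramanujanLin (k : ℕ) : formsOfWeight k →ₗ[ℂ] formsOfWeight (k + 2) where
  toFun f := ⟨ramanujan k f, ramanujan_mem f.2⟩
  map_add' f g := Subtype.ext (by
    simp only [ramanujan_eq_serreDerivative]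
    exact serreDerivative_add k f g (mdifferentiable_of_mem f.2) (mdifferentiable_of_mem g.2))
  map_smul' c f := Subtype.ext (by
    simp only [ramanujan_eq_serreDerivative]
    exact serreDerivative_smul k c f (mdifferentiable_of_mem f.2))

/-- The derivation `X` of `ℳ`. -/
def formsX : Forms →ₗ[ℂ] Forms :=
  DirectSum.toModule ℂ ℕ Forms fun k =>
    DirectSum.lof ℂ ℕ (fun k => formsOfWeight k) (k + 2) ∘ₗ ramanujanLin k

/-- The derivation `Y` of `ℳ`. -/
def formsY : Forms →ₗ[ℂ] Forms :=
  DirectSum.toModule ℂ ℕ Forms fun k =>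
    ((k : ℂ) / 2) • DirectSum.lof ℂ ℕ (fun k => formsOfWeight k) k

theorem formsX_of (k : ℕ) (f : formsOfWeight k) :
    formsX (DirectSum.of (fun k => formsOfWeight k) k f)
      = DirectSum.of (fun k => formsOfWeight k) (k + 2) (ramanujanLin k f) := by
  rw [formsX, ← DirectSum.lof_eq_of ℂ, DirectSum.toModule_lof]
  rfl

theorem formsY_of (k : ℕ) (f : formsOfWeight k) :
    formsY (DirectSum.of (fun k => formsOfWeight k) k f)
      = ((k : ℂ) / 2) • DirectSum.of (fun k => formsOfWeight k) k f := by
  rw [formsY, ← DirectSum.lof_eq_of ℂ, DirectSum.toModule_lof]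
  rfl

theorem of_smul {k : ℕ} (c : ℂ) (f : formsOfWeight k) :
    DirectSum.of (fun k => formsOfWeight k) k (c • f)
      = c • DirectSum.of (fun k => formsOfWeight k) k f :=
  (DirectSum.lof ℂ ℕ (fun k => formsOfWeight k) k).map_smul c f

theorem forms_smul_mul (c : ℂ) (a b : Forms) : (c • a) * b = c • (a * b) :=
  Algebra.smul_mul_assoc c a b

theorem forms_mul_smul (c : ℂ) (a b : Forms) : a * (c • b) = c • (a * b) :=
  Algebra.mul_smul_comm c a b

/-- Multiplication by a form. -/
def formMul (m : Forms) : Forms →ₗ[ℂ] Forms where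
  toFun a := m * a
  map_add' := mul_add m
  map_smul' c a := forms_mul_smul c m a

theorem formMul_apply (m a : Forms) : formMul m a = m * a := rfl

theorem formsX_mul (a b : Forms) : formsX (a * b) = formsX a * b + a * formsX b := by
  induction a using DirectSum.induction_on with
  | zero => simp
  | add x y hx hy => simp only [add_mul, map_add, hx, hy]; abel
  | of i f =>
    induction b using DirectSum.induction_on with
    | zero => simp
    | add x y hx hy => simp only [mul_add, map_add, hx, hy]; abel
    | of j g =>
      simp only [formsX_of, DirectSum.of_mul_of]
      refine (of_add_of (by ring) (by ring) ?_).symm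
      exact (ramanujan_mul i j (mdifferentiable_of_mem f.2) (mdifferentiable_of_mem g.2)).symm

theorem formsY_mul (a b : Forms) : formsY (a * b) = formsY a * b + a * formsY b := by
  induction a using DirectSum.induction_on with
  | zero => simp
  | add x y hx hy => simp only [add_mul, map_add, hx, hy]; abel
  | of i f =>
    induction b using DirectSum.induction_on with
    | zero => simp
    | add x y hx hy => simp only [mul_add, map_add, hx, hy]; abel
    | of j g =>
      rw [formsY_of, formsY_of, forms_smul_mul, forms_mul_smul, DirectSum.of_mul_of, formsY_of,
        Nat.cast_add, add_div]
      exact add_smul _ _ _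

theorem formsY_formsX (a : Forms) : formsY (formsX a) = formsX (formsY a) + formsX a := by
  induction a using DirectSum.induction_on with
  | zero => simp
  | add x y hx hy => simp only [map_add, hx, hy]; abel
  | of i f =>
    rw [formsY_of, map_smul, formsX_of, formsY_of, Nat.cast_add, Nat.cast_ofNat, add_div,
      div_self two_ne_zero]
    exact (add_smul _ _ _).trans (congrArg _ (one_smul _ _))

theorem formsX_one : formsX 1 = 0 := by
  have h := formsX_mul 1 1
  rw [mul_one, mul_one, one_mul] at h
  -- Additive cancellation in `Forms` is obtained from its ℂ-module structure.
  let _ : AddCommGroup Forms := Module.addCommMonoidToAddCommGroup ℂ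
  exact left_eq_add.mp h

theorem formsY_one : formsY 1 = 0 := by
  have h := formsY_mul 1 1
  rw [mul_one, mul_one, one_mul] at h
  let _ : AddCommGroup Forms := Module.addCommMonoidToAddCommGroup ℂ
  exact left_eq_add.mp h

/-- `μ_γ` as an element of `ℳ`. -/
def muForm (γ : GPlus) : Forms := DirectSum.of (fun k => formsOfWeight k) 2 ⟨mu γ, mu_mem γ⟩

theorem muForm_mul (α β : GPlus) : muForm (α * β) = slashHom β (muForm α) + muForm β := by
  rw [muForm, muForm, muForm, slashHom_of]
  exact (of_add_of rfl rfl (mu_mul α β).symm).symm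

theorem muForm_one : muForm 1 = 0 := by
  have h : (⟨mu 1, mu_mem 1⟩ : formsOfWeight 2) = 0 := Subtype.ext mu_one
  rw [muForm, h, map_zero]

theorem formsY_muForm (γ : GPlus) : formsY (muForm γ) = muForm γ := by
  rw [muForm, formsY_of, Nat.cast_ofNat, div_self two_ne_zero]
  exact one_smul _ _

theorem formsY_slashHom (γ : GPlus) (a : Forms) :
    formsY (slashHom γ a) = slashHom γ (formsY a) := by
  induction a using DirectSum.induction_on with
  | zero => simp
  | add x y hx hy => simp only [map_add, hx, hy]
  | of i f => rw [slashHom_of, formsY_of, formsY_of, map_smul, slashHom_of]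

theorem formsX_slashHom (γ : GPlus) (a : Forms) :
    formsX (slashHom γ a) = slashHom γ (formsX a) + muForm γ * slashHom γ (formsY a) := by
  induction a using DirectSum.induction_on with
  | zero => simp
  | add x y hx hy => simp only [map_add, hx, hy, mul_add]; abel
  | of i f =>
    rw [slashHom_of, formsX_of, formsX_of, slashHom_of, formsY_of, map_smul, slashHom_of, muForm,
      ← of_smul, DirectSum.of_mul_of]
    refine (of_add_of rfl (by ring) ?_).symm
    exact (ramanujan_slash i γ (mdifferentiable_of_mem f.2)).symm

/-! ### The action of the generators on the crossed product -/

/-- The operator on `𝒜` that acts on the coefficients of `U_γ^*` by `T γ`. -/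
def coeffOp (T : GPlusᵐᵒᵖ → Forms →ₗ[ℂ] Forms) : Module.End ℂ Crossed :=
  Finsupp.lsum ℂ (fun g => SkewMonoidAlgebra.lsingle ℂ g ∘ₗ T g) ∘ₗ
    (SkewMonoidAlgebra.coeffLinearEquiv (S := ℂ)).toLinearMap

theorem coeffOp_single (T : GPlusᵐᵒᵖ → Forms →ₗ[ℂ] Forms) (g : GPlusᵐᵒᵖ) (a : Forms) :
    coeffOp T (SkewMonoidAlgebra.single g a) = SkewMonoidAlgebra.single g (T g a) := by
  change Finsupp.lsum ℂ (fun g => SkewMonoidAlgebra.lsingle ℂ g ∘ₗ T g) (Finsupp.single g a) = _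
  rw [Finsupp.lsum_single]
  rfl

theorem crossed_hom_ext {M : Type*} [AddCommMonoid M] [Module ℂ M] {φ ψ : Crossed →ₗ[ℂ] M}
    (h : ∀ g a, φ (SkewMonoidAlgebra.single g a) = ψ (SkewMonoidAlgebra.single g a)) : φ = ψ :=
  SkewMonoidAlgebra.lhom_ext h

/-- The bracket [S, T] = R, checked coefficientwise and written without subtraction. -/
theorem coeffOp_commutator {S T R : GPlusᵐᵒᵖ → Forms →ₗ[ℂ] Forms}
    (h : ∀ g a, S g (T g a) = T g (S g a) + R g a) :
    coeffOp S * coeffOp T = coeffOp T * coeffOp S + coeffOp R := by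
  refine crossed_hom_ext fun g a => ?_
  rw [LinearMap.add_apply, Module.End.mul_apply, Module.End.mul_apply]
  simp only [coeffOp_single]
  rw [h, SkewMonoidAlgebra.single_add]

/-- The coefficient by which `δ_n` multiplies the terms in `U_γ^*`: the form `X^{n-1} μ_γ`. -/
def deltaForm (γ : GPlus) (n : ℕ+) : Forms := PNat.recOn n (muForm γ) (fun _ a => formsX a)

theorem deltaForm_one (γ : GPlus) : deltaForm γ 1 = muForm γ := PNat.recOn_one _ _

theorem deltaForm_succ (γ : GPlus) (n : ℕ+) : deltaForm γ (n + 1) = formsX (deltaForm γ n) :=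
  PNat.recOn_succ _ _ _

theorem formsY_deltaForm (γ : GPlus) (n : ℕ+) :
    formsY (deltaForm γ n) = ((n : ℕ) : ℂ) • deltaForm γ n := by
  induction n using PNat.recOn with
  | one =>
    rw [deltaForm_one, formsY_muForm, PNat.one_coe, Nat.cast_one]
    exact (one_smul _ _).symm
  | succ n ih =>
    rw [deltaForm_succ, formsY_formsX, ih, map_smul, PNat.add_coe, PNat.one_coe, Nat.cast_add,
      Nat.cast_one]
    exact ((add_smul _ _ _).trans (congrArg _ (one_smul _ _))).symm

/-- `X` on `𝒜`. -/
def opX : Module.End ℂ Crossed := coeffOp fun _ => formsX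

/-- `Y` on `𝒜`. -/
def opY : Module.End ℂ Crossed := coeffOp fun _ => formsY

/-- `δ_n` on `𝒜`. -/
def opDelta (n : ℕ+) : Module.End ℂ Crossed :=
  coeffOp fun g => formMul (deltaForm g.unop n)

theorem smul_opDelta (n : ℕ+) : ((n : ℕ) : ℂ) • opDelta n
    = coeffOp fun g => ((n : ℕ) : ℂ) • formMul (deltaForm g.unop n) := by
  refine crossed_hom_ext fun g a => ?_
  rw [LinearMap.smul_apply, opDelta, coeffOp_single, coeffOp_single, SkewMonoidAlgebra.smul_single]
  rfl

/-- The ring structure of `End 𝒜`, extending its semiring structure. -/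
abbrev endRing : Ring (Module.End ℂ Crossed) := Algebra.semiringToRing ℂ

attribute [local instance] endRing

/-- The action of `ℋ₁` on `𝒜`. -/
def modularAction : H1 →ₐ[ℂ] Module.End ℂ Crossed :=
  H1.lift opX opY opDelta
    (sub_eq_iff_eq_add'.mpr (coeffOp_commutator fun _ a => formsY_formsX a))
    -- Here and in the next argument: the bracket of a derivation ∂ with multiplication by m is
    -- multiplication by ∂(m).
    (fun n => sub_eq_iff_eq_add'.mpr (by
      rw [smul_opDelta]
      refine coeffOp_commutator fun g a => ?_
      rw [formMul_apply, formMul_apply, formsY_mul, formsY_deltaForm, forms_smul_mul, add_comm]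
      rfl))
    (fun n => sub_eq_iff_eq_add'.mpr (coeffOp_commutator fun g a => by
      rw [formMul_apply, formMul_apply, formMul_apply, formsX_mul, deltaForm_succ, add_comm]))
    (fun k l => crossed_hom_ext fun g a => by
      rw [Module.End.mul_apply, Module.End.mul_apply]
      simp only [opDelta, coeffOp_single, formMul_apply]
      rw [mul_left_comm])

theorem modularAction_X : modularAction H1.X = opX := H1.lift_X ..

theorem modularAction_Y : modularAction H1.Y = opY := H1.lift_Y ..

theorem modularAction_delta (n : ℕ+) : modularAction (H1.delta n) = opDelta n := H1.lift_delta ..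

/-! ### Hopf actions -/

/-- The Leibniz rule and the unit rule need only be checked on generators. -/
theorem isHopfAction_of_gen {ρ : H1 →ₐ[ℂ] Module.End ℂ Crossed}
    (hX : ∀ a b, ρ H1.X (a * b)
      = ρ H1.X a * b + a * ρ H1.X b + ρ (H1.delta 1) a * ρ H1.Y b)
    (hY : ∀ a b, ρ H1.Y (a * b) = ρ H1.Y a * b + a * ρ H1.Y b)
    (hd : ∀ a b, ρ (H1.delta 1) (a * b) = ρ (H1.delta 1) a * b + a * ρ (H1.delta 1) b)
    (hX1 : ρ H1.X 1 = 0) (hY1 : ρ H1.Y 1 = 0) (hd1 : ρ (H1.delta 1) 1 = 0) :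
    IsHopfAction ρ := by
  let act (a b : Crossed) : H1 ⊗[ℂ] H1 →ₗ[ℂ] Crossed := TensorProduct.lift
    ((LinearMap.mul ℂ Crossed).compl₁₂ (ρ.toLinearMap.flip a) (ρ.toLinearMap.flip b))
  have act_tmul (a b : Crossed) (h h' : H1) : act a b (h ⊗ₜ h') = ρ h a * ρ h' b := rfl
  have act_mul (a b : Crossed) (t : H1 ⊗[ℂ] H1) (c d : H1) :
      act a b (t * c ⊗ₜ d) = act (ρ c a) (ρ d b) t := by
    induction t using TensorProduct.induction_on with
    | zero => simp
    | add s t hs ht => rw [add_mul, map_add, map_add, hs, ht]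
    | tmul h h' =>
      rw [Algebra.TensorProduct.tmul_mul_tmul, act_tmul, act_tmul, map_mul, map_mul]
      rfl
  -- The elements that obey the Leibniz rule form a subalgebra because Δ is multiplicative; Q plays
  -- the same role for ε and the unit rule.
  let P : Subalgebra ℂ H1 :=
    { carrier := {h | ∀ a b, ρ h (a * b) = act a b (H1.comulHom h)}
      mul_mem' := by
        intro h h' hh hh' a b
        have key (t : H1 ⊗[ℂ] H1) : ρ h (act a b t) = act a b (H1.comulHom h * t) := by
          induction t using TensorProduct.induction_on with
          | zero => simp
          | add s t hs ht => rw [map_add, map_add, hs, ht, mul_add, map_add]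
          | tmul c d => rw [act_mul, act_tmul, hh]
        rw [map_mul ρ, map_mul H1.comulHom, Module.End.mul_apply, hh', key]
      add_mem' := by
        intro h h' hh hh' a b
        rw [map_add, map_add, map_add, LinearMap.add_apply, hh, hh']
      algebraMap_mem' := by
        intro r a b
        rw [AlgHom.commutes, AlgHom.commutes, Algebra.TensorProduct.algebraMap_apply, act_tmul,
          map_one, AlgHom.commutes, Module.algebraMap_end_apply, Module.algebraMap_end_apply,
          Module.End.one_apply, smul_mul_assoc] }
  let Q : Subalgebra ℂ H1 :=
    { carrier := {h | ρ h 1 = H1.counitHom h • (1 : Crossed)}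
      mul_mem' := by
        intro h h' (hh : _ = _) (hh' : _ = _)
        change _ = _
        rw [map_mul, map_mul, Module.End.mul_apply, hh', map_smul, hh, smul_smul, mul_comm]
      add_mem' := by
        intro h h' (hh : _ = _) (hh' : _ = _)
        change _ = _
        rw [map_add, map_add, LinearMap.add_apply, hh, hh', add_smul]
      algebraMap_mem' := by
        intro r
        change _ = _
        rw [AlgHom.commutes, AlgHom.commutes, Module.algebraMap_end_apply]
        rfl }
  refine ⟨fun h => H1.mem_of_gen P ?_ ?_ ?_ h, fun h => H1.mem_of_gen Q ?_ ?_ ?_ h⟩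
  · intro a b
    rw [hX, H1.comulHom_X, map_add, map_add, act_tmul, act_tmul, act_tmul, map_one]
    rfl
  · intro a b
    rw [hY, H1.comulHom_Y, map_add, act_tmul, act_tmul, map_one]
    rfl
  · intro a b
    rw [hd, H1.comulHom_delta_one, map_add, act_tmul, act_tmul, map_one]
    rfl
  · change _ = _
    rw [hX1, H1.counitHom_X, zero_smul]
  · change _ = _
    rw [hY1, H1.counitHom_Y, zero_smul]
  · change _ = _
    rw [hd1, H1.counitHom_delta, zero_smul]

/-- Identities between bilinear expressions on `𝒜` need only be checked on monomials. -/
theorem crossed_bilin_ext {φ ψ : Crossed →ₗ[ℂ] Crossed →ₗ[ℂ] Crossed}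
    (h : ∀ g a g' a', φ (SkewMonoidAlgebra.single g a) (SkewMonoidAlgebra.single g' a')
      = ψ (SkewMonoidAlgebra.single g a) (SkewMonoidAlgebra.single g' a')) (x y : Crossed) :
    φ x y = ψ x y :=
  LinearMap.congr_fun (LinearMap.congr_fun
    (crossed_hom_ext fun g a => crossed_hom_ext fun g' a' => h g a g' a') x) y

theorem single_mul_single_eq (α β : GPlus) (a b : Forms) :
    (SkewMonoidAlgebra.single (MulOpposite.op α) a * SkewMonoidAlgebra.single (MulOpposite.op β) b :
      Crossed) = SkewMonoidAlgebra.single (MulOpposite.op (β * α)) (a * slashHom α b) :=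
  SkewMonoidAlgebra.single_mul_single

/-- On monomials the rule for X amounts to `formsX_slashHom`, the rule for δ₁ to the cocycle
relation `muForm_mul`, and the rule for Y to the slash preserving weight. In each case φ and ψ are
the two sides as bilinear maps. -/
theorem isHopfAction_modularAction : IsHopfAction modularAction := by
  refine isHopfAction_of_gen ?_ ?_ ?_ ?_ ?_ ?_ <;> simp only [modularAction_X, modularAction_Y, modularAction_delta]
  · refine crossed_bilin_ext (φ := (LinearMap.mul ℂ Crossed).compr₂ opX)
      (ψ := (LinearMap.mul ℂ Crossed).compl₁₂ opX LinearMap.id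
        + (LinearMap.mul ℂ Crossed).compl₁₂ LinearMap.id opX
        + (LinearMap.mul ℂ Crossed).compl₁₂ (opDelta 1) opY) ?_
    rintro ⟨α⟩ a ⟨β⟩ b
    change opX (SkewMonoidAlgebra.single (MulOpposite.op α) a
        * SkewMonoidAlgebra.single (MulOpposite.op β) b)
      = opX (SkewMonoidAlgebra.single (MulOpposite.op α) a)
        * SkewMonoidAlgebra.single (MulOpposite.op β) b
      + SkewMonoidAlgebra.single (MulOpposite.op α) a
        * opX (SkewMonoidAlgebra.single (MulOpposite.op β) b)
      + opDelta 1 (SkewMonoidAlgebra.single (MulOpposite.op α) a)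
        * opY (SkewMonoidAlgebra.single (MulOpposite.op β) b)
    simp only [opX, opY, opDelta, coeffOp_single, single_mul_single_eq,
      ← SkewMonoidAlgebra.single_add, formsX_mul, formsX_slashHom, formMul_apply,
      deltaForm_one, MulOpposite.unop_op]
    congr 1
    ring
  · refine crossed_bilin_ext (φ := (LinearMap.mul ℂ Crossed).compr₂ opY)
      (ψ := (LinearMap.mul ℂ Crossed).compl₁₂ opY LinearMap.id
        + (LinearMap.mul ℂ Crossed).compl₁₂ LinearMap.id opY) ?_
    rintro ⟨α⟩ a ⟨β⟩ b
    change opY (SkewMonoidAlgebra.single (MulOpposite.op α) a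
        * SkewMonoidAlgebra.single (MulOpposite.op β) b)
      = opY (SkewMonoidAlgebra.single (MulOpposite.op α) a)
        * SkewMonoidAlgebra.single (MulOpposite.op β) b
      + SkewMonoidAlgebra.single (MulOpposite.op α) a
        * opY (SkewMonoidAlgebra.single (MulOpposite.op β) b)
    simp only [opY, coeffOp_single, single_mul_single_eq,
      ← SkewMonoidAlgebra.single_add, formsY_mul, formsY_slashHom]
  · refine crossed_bilin_ext (φ := (LinearMap.mul ℂ Crossed).compr₂ (opDelta 1))
      (ψ := (LinearMap.mul ℂ Crossed).compl₁₂ (opDelta 1) LinearMap.id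
        + (LinearMap.mul ℂ Crossed).compl₁₂ LinearMap.id (opDelta 1)) ?_
    rintro ⟨α⟩ a ⟨β⟩ b
    change opDelta 1 (SkewMonoidAlgebra.single (MulOpposite.op α) a
        * SkewMonoidAlgebra.single (MulOpposite.op β) b)
      = opDelta 1 (SkewMonoidAlgebra.single (MulOpposite.op α) a)
        * SkewMonoidAlgebra.single (MulOpposite.op β) b
      + SkewMonoidAlgebra.single (MulOpposite.op α) a
        * opDelta 1 (SkewMonoidAlgebra.single (MulOpposite.op β) b)
    simp only [opDelta, coeffOp_single, single_mul_single_eq,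
      ← SkewMonoidAlgebra.single_add, formMul_apply, deltaForm_one, muForm_mul,
      MulOpposite.unop_op, map_mul]
    congr 1
    ring
  · rw [SkewMonoidAlgebra.one_def, opX, coeffOp_single, formsX_one, SkewMonoidAlgebra.single_zero]
  · rw [SkewMonoidAlgebra.one_def, opY, coeffOp_single, formsY_one, SkewMonoidAlgebra.single_zero]
  · rw [SkewMonoidAlgebra.one_def, opDelta, coeffOp_single, formMul_apply, deltaForm_one,
      MulOpposite.unop_one, muForm_one, zero_mul, SkewMonoidAlgebra.single_zero]

/-! ### Existence and uniqueness of the action -/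

theorem isModularAction_modularAction : IsModularAction modularAction where
  hopf := isHopfAction_modularAction
  X_apply k f γ := by
    refine ⟨ramanujanLin k f, rfl, ?_⟩
    rw [modularAction_X, symb, opX, coeffOp_single, formsX_of]
    rfl
  Y_apply k f γ := by
    rw [modularAction_Y, symb, opY, coeffOp_single, formsY_of,
      ← of_smul]
    rfl
  delta_one_apply k f γ := by
    refine ⟨⟨mu γ * f, ?_⟩, rfl, ?_⟩
    · rw [add_comm]
      exact SetLike.mul_mem_graded (mu_mem γ) f.2
    · rw [modularAction_delta, symb, opDelta,
        coeffOp_single, formMul_apply, deltaForm_one, MulOpposite.unop_op, muForm,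
        DirectSum.of_mul_of, symb]
      -- The product of μ_γ and f has weight 2 + k, the target weight k + 2.
      exact congrArg _ (of_eq_of (add_comm _ _) rfl)

theorem symb_hom_ext {φ ψ : Module.End ℂ Crossed}
    (h : ∀ (k : ℕ) (f : formsOfWeight k) (γ : GPlus), φ (symb f γ) = ψ (symb f γ)) : φ = ψ := by
  refine crossed_hom_ext ?_
  intro γ a
  induction a using DirectSum.induction_on with
  | zero => rw [SkewMonoidAlgebra.single_zero, map_zero, map_zero]
  | add x y hx hy => rw [SkewMonoidAlgebra.single_add, map_add, map_add, hx, hy]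
  | of i f => exact h i f γ.unop

/-- Uniqueness: X, Y, δ₁ generate ℋ₁, the symbols span 𝒜, and the values prescribed on symbols are
determined as functions on ℍ. -/
theorem existsUnique_isModularAction :
    ∃! ρ : H1 →ₐ[ℂ] Module.End ℂ Crossed, IsModularAction ρ := by
  refine ⟨modularAction, isModularAction_modularAction, fun ρ hρ => ?_⟩
  have hm := isModularAction_modularAction
  refine H1.hom_ext (symb_hom_ext fun k f γ => ?_) (symb_hom_ext fun k f γ => ?_)
    (symb_hom_ext fun k f γ => ?_)
  · obtain ⟨g, hg, e⟩ := hρ.X_apply k f γ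
    obtain ⟨g', hg', e'⟩ := hm.X_apply k f γ
    rw [e, e', Subtype.ext (hg.trans hg'.symm)]
  · rw [hρ.Y_apply, hm.Y_apply]
  · obtain ⟨g, hg, e⟩ := hρ.delta_one_apply k f γ
    obtain ⟨g', hg', e'⟩ := hm.delta_one_apply k f γ
    rw [e, e', Subtype.ext (hg.trans hg'.symm)]

/-! ### The coordinate `Z` -/

/-- `η⁴` decays exponentially, uniformly on half-planes `Im z ≥ y`. -/
theorem exists_norm_eta_pow_four_le {y : ℝ} (hy : 0 < y) :
    ∃ C : ℝ, 0 ≤ C ∧ ∀ z : ℂ, y ≤ z.im → ‖η z ^ 4‖ ≤ C * Real.exp (-(Real.pi / 3) * z.im) := by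
  have hr : Real.exp (-2 * Real.pi * y) < 1 := by
    rw [Real.exp_lt_one_iff]
    nlinarith [mul_pos Real.pi_pos hy]
  -- In η = q^{1/24} ∏(1 − qⁿ) the product is bounded on the compact disc |q| ≤ e^{−2πy}; the fourth
  -- power of the prefactor has modulus e^{−π Im z/3}.
  have hcont : ContinuousOn (fun q : ℂ => ∏' n : ℕ, (1 - q ^ (n + 1)))
      (Metric.closedBall 0 (Real.exp (-2 * Real.pi * y))) :=
    differentiableOn_tprod_one_sub_pow.continuousOn.mono
      (Metric.closedBall_subset_ball hr)
  obtain ⟨M, hM⟩ := (isCompact_closedBall (0 : ℂ) _).exists_bound_of_continuousOn hcont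
  have hM0 : 0 ≤ M := (norm_nonneg _).trans (hM 0 (Metric.mem_closedBall_self (Real.exp_pos _).le))
  refine ⟨M ^ 4, by positivity, fun z hz => ?_⟩
  have hq : Function.Periodic.qParam 1 z ∈ Metric.closedBall (0 : ℂ)
      (Real.exp (-2 * Real.pi * y)) := by
    rw [mem_closedBall_zero_iff, Function.Periodic.norm_qParam]
    refine Real.exp_le_exp.mpr ?_
    nlinarith [mul_le_mul_of_nonneg_left hz Real.pi_pos.le]
  have e : Real.exp (-2 * Real.pi * z.im / 24) ^ 4 = Real.exp (-(Real.pi / 3) * z.im) := by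
    rw [← Real.exp_nat_mul]; congr 1; push_cast; ring
  rw [norm_pow, eta, norm_mul, Function.Periodic.norm_qParam, mul_pow, e, mul_comm]
  gcongr
  exact hM _ hq

theorem differentiableAt_eta_pow_four {z : ℂ} (hz : 0 < z.im) :
    DifferentiableAt ℂ (fun w => η w ^ 4) z :=
  (differentiableAt_eta_of_mem_upperHalfPlaneSet hz).fun_pow 4

/-- The derivative of `η⁴` decays exponentially, uniformly on half-planes `Im z ≥ y`. -/
theorem exists_norm_deriv_eta_pow_four_le {y : ℝ} (hy : 0 < y) :
    ∃ C : ℝ, 0 ≤ C ∧ ∀ z : ℂ, y ≤ z.im →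
      ‖deriv (fun w => η w ^ 4) z‖ ≤ C * Real.exp (-(Real.pi / 3) * z.im) := by
  obtain ⟨C, hC0, hC⟩ := exists_norm_eta_pow_four_le (half_pos hy)
  -- Cauchy's estimate on the disc of radius y/2: the exponential compensates for the loss of height
  -- y/2.
  refine ⟨C * Real.exp (Real.pi / 3 * (y / 2)) / (y / 2), by positivity, fun z hz => ?_⟩
  have him : ∀ w ∈ Metric.closedBall z (y / 2), z.im - y / 2 ≤ w.im := by
    intro w hw
    have h1 : |(w - z).im| ≤ y / 2 :=
      (Complex.abs_im_le_norm _).trans (by simpa [dist_eq_norm] using hw)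
    have h2 := (abs_le.mp h1).1
    rw [Complex.sub_im] at h2
    linarith
  have hd : DifferentiableOn ℂ (fun w => η w ^ 4) (Metric.closedBall z (y / 2)) := fun w hw =>
    (differentiableAt_eta_pow_four (by linarith [him w hw])).differentiableWithinAt
  have key := Complex.norm_deriv_le_of_forall_mem_sphere_norm_le (half_pos hy)
    (hd.diffContOnCl_ball subset_rfl)
    (C := C * Real.exp (-(Real.pi / 3) * (z.im - y / 2))) (fun w hw => by
      have hw' := him w (Metric.sphere_subset_closedBall hw)
      refine (hC w (by linarith)).trans (mul_le_mul_of_nonneg_left (Real.exp_le_exp.mpr ?_) hC0)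
      nlinarith [mul_le_mul_of_nonneg_left hw' Real.pi_pos.le])
  refine key.trans (le_of_eq ?_)
  have e : Real.exp (-(Real.pi / 3) * (z.im - y / 2))
      = Real.exp (Real.pi / 3 * (y / 2)) * Real.exp (-(Real.pi / 3) * z.im) := by
    rw [← Real.exp_add]; congr 1; ring
  rw [e]
  ring

open MeasureTheory Filter in
-- Exponential decay justifies differentiating under the integral sign. The differentiated integrand
-- is d/dt of η(z + it)⁴, so its integral is the boundary difference 0 − η(z)⁴.
theorem hasDerivAt_integral_eta_pow_four {z : ℂ} (hz : 0 < z.im) :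
    HasDerivAt (fun w : ℂ => ∫ t in Set.Ioi (0 : ℝ), η (w + t * Complex.I) ^ 4 * Complex.I)
      (-η z ^ 4) z := by
  have him (w : ℂ) (t : ℝ) : (w + t * Complex.I).im = w.im + t := by simp
  have hy := half_pos hz
  obtain ⟨C, hC0, hC⟩ := exists_norm_eta_pow_four_le hz
  obtain ⟨C', hC'0, hC'⟩ := exists_norm_deriv_eta_pow_four_le hy
  have hpi : 0 < Real.pi / 3 := by positivity
  have hexp : IntegrableOn (fun t : ℝ => Real.exp (-(Real.pi / 3) * t)) (Set.Ioi 0) :=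
    integrableOn_exp_mul_Ioi (by linarith) 0
  have hball : ∀ w ∈ Metric.ball z (z.im / 2), z.im / 2 < w.im := by
    intro w hw
    have h1 : |(w - z).im| < z.im / 2 :=
      (Complex.abs_im_le_norm _).trans_lt (by simpa [dist_eq_norm] using hw)
    have h2 := (abs_lt.mp h1).1
    rw [Complex.sub_im] at h2
    linarith
  have hshift (w : ℂ) (t : ℝ) : HasDerivAt (fun t : ℝ => w + t * Complex.I) Complex.I t := by
    simpa using (Complex.ofRealCLM.hasDerivAt.mul_const Complex.I).const_add w
  have hshiftc (w : ℂ) : Continuous (fun t : ℝ => w + t * Complex.I) := by fun_prop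
  have hmaps {w : ℂ} (hw : 0 < w.im) :
      Set.MapsTo (fun t : ℝ => w + t * Complex.I) (Set.Ici 0) {z : ℂ | 0 < z.im} := by
    intro t (ht : 0 ≤ t)
    change 0 < (w + t * Complex.I).im
    rw [him]; linarith
  have hd : DifferentiableOn ℂ (fun w => η w ^ 4) {z : ℂ | 0 < z.im} := fun w hw =>
    (differentiableAt_eta_pow_four hw).differentiableWithinAt
  have hF {w : ℂ} (hw : 0 < w.im) :
      ContinuousOn (fun t : ℝ => η (w + t * Complex.I) ^ 4) (Set.Ici 0) :=
    hd.continuousOn.comp (hshiftc w).continuousOn (hmaps hw)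
  have hF' : ContinuousOn (fun t : ℝ => deriv (fun w => η w ^ 4) (z + t * Complex.I))
      (Set.Ici 0) :=
    (hd.deriv isOpen_upperHalfPlaneSet).continuousOn.comp (hshiftc z).continuousOn (hmaps hz)
  have hle {t : ℝ} {w : ℂ} (hw : 0 ≤ w.im) :
      Real.exp (-(Real.pi / 3) * (w + t * Complex.I).im) ≤ Real.exp (-(Real.pi / 3) * t) := by
    rw [him]
    refine Real.exp_le_exp.mpr ?_
    nlinarith [mul_nonneg hpi.le hw]
  have hint : IntegrableOn (fun t : ℝ => η (z + t * Complex.I) ^ 4 * Complex.I) (Set.Ioi 0) := by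
    refine Integrable.mono' (hexp.const_mul C) ?_ ?_
    · exact (((hF hz).mono Set.Ioi_subset_Ici_self).mul continuousOn_const).aestronglyMeasurable
        measurableSet_Ioi
    · refine (ae_restrict_iff' measurableSet_Ioi).mpr (.of_forall fun t (ht : 0 < t) => ?_)
      rw [norm_mul, Complex.norm_I, mul_one]
      exact (hC _ (by rw [him]; linarith)).trans (mul_le_mul_of_nonneg_left (hle hz.le) hC0)
  obtain ⟨hi, hderiv⟩ := hasDerivAt_integral_of_dominated_loc_of_deriv_le
    (μ := volume.restrict (Set.Ioi (0 : ℝ)))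
    (F := fun (w : ℂ) (t : ℝ) => η (w + t * Complex.I) ^ 4 * Complex.I)
    (F' := fun (w : ℂ) (t : ℝ) => deriv (fun w => η w ^ 4) (w + t * Complex.I) * Complex.I)
    (x₀ := z) (s := Metric.ball z (z.im / 2))
    (bound := fun t => C' * Real.exp (-(Real.pi / 3) * t))
    (Metric.ball_mem_nhds z hy)
    (by
      filter_upwards [Metric.ball_mem_nhds z hy] with w hw
      exact (((hF (hy.trans (hball w hw))).mono Set.Ioi_subset_Ici_self).mul
        continuousOn_const).aestronglyMeasurable measurableSet_Ioi)
    hint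
    (((hF'.mono Set.Ioi_subset_Ici_self).mul continuousOn_const).aestronglyMeasurable
      measurableSet_Ioi)
    (by
      refine (ae_restrict_iff' measurableSet_Ioi).mpr (.of_forall fun t (ht : 0 < t) w hw => ?_)
      have hw' := hball w hw
      rw [norm_mul, Complex.norm_I, mul_one]
      exact (hC' _ (by rw [him]; linarith)).trans
        (mul_le_mul_of_nonneg_left (hle (hy.trans hw').le) hC'0))
    (hexp.const_mul C')
    (by
      refine (ae_restrict_iff' measurableSet_Ioi).mpr (.of_forall fun t (ht : 0 < t) w hw => ?_)
      have hw' : 0 < (w + t * Complex.I).im := by rw [him]; linarith [hball w hw]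
      exact ((differentiableAt_eta_pow_four hw').hasDerivAt.comp_add_const w
        (t * Complex.I)).mul_const Complex.I)
  have hval : ∫ t in Set.Ioi (0 : ℝ), deriv (fun w => η w ^ 4) (z + t * Complex.I) * Complex.I
      = 0 - η (z + (0 : ℝ) * Complex.I) ^ 4 := by
    refine integral_Ioi_of_hasDerivAt_of_tendsto
      (f := fun t : ℝ => η (z + t * Complex.I) ^ 4) ?_ ?_ hi ?_
    · exact hF hz 0 Set.self_mem_Ici
    · intro t (ht : 0 < t)
      have ht' : 0 < (z + t * Complex.I).im := by rw [him]; linarith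
      exact HasDerivAt.comp t (differentiableAt_eta_pow_four ht').hasDerivAt (hshift z t)
    · have hlim : Tendsto (fun t : ℝ => C * Real.exp (-(Real.pi / 3) * t)) atTop (nhds 0) := by
        have h0 : Tendsto (fun t : ℝ => -(Real.pi / 3) * t) atTop atBot :=
          tendsto_id.const_mul_atTop_of_neg (by linarith)
        simpa using (Real.tendsto_exp_atBot.comp h0).const_mul C
      refine squeeze_zero_norm' ?_ hlim
      filter_upwards [eventually_gt_atTop 0] with t ht
      exact (hC _ (by rw [him]; linarith)).trans (mul_le_mul_of_nonneg_left (hle hz.le) hC0)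
  rw [hval] at hderiv
  simpa using hderiv

theorem hasDerivAt_eichlerZ (z : ℍ) :
    HasDerivAt (eichlerZ ∘ ofComplex)
      (2 * Real.pi * Complex.I / 6 * η (z : ℂ) ^ 4) (z : ℂ) := by
  have h := (hasDerivAt_integral_eta_pow_four z.im_pos).neg.const_mul
    (2 * Real.pi * Complex.I / 6 : ℂ)
  rw [neg_neg] at h
  refine h.congr_of_eventuallyEq ?_
  filter_upwards [isOpen_upperHalfPlaneSet.mem_nhds z.im_pos] with w hw
  simp [eichlerZ, ofComplex_apply_of_im_pos hw]

theorem eichlerZ_mdifferentiable : MDiff eichlerZ := fun z =>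
  UpperHalfPlane.mdifferentiableAt_iff.mpr (hasDerivAt_eichlerZ z).differentiableAt

theorem D_eichlerZ : D eichlerZ = (6⁻¹ : ℂ) • etaFour := by
  ext z
  have := Complex.two_pi_I_ne_zero
  rw [normalizedDerivOfComplex, (hasDerivAt_eichlerZ z).deriv, Pi.smul_apply, smul_eq_mul, etaFour]
  field_simp

theorem D_eichlerZ_ne_zero (z : ℍ) : D eichlerZ z ≠ 0 := by
  rw [D_eichlerZ]
  exact mul_ne_zero (by norm_num) (etaFour_ne_zero z)

theorem ddZ_eq (F : ℍ → ℂ) : ddZ F = D F / D eichlerZ := by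
  ext z
  exact (mul_div_mul_left _ _ (inv_ne_zero Complex.two_pi_I_ne_zero)).symm

theorem ddZ_mul_D (F : ℍ → ℂ) (z : ℍ) : ddZ F z * D eichlerZ z = D F z := by
  rw [ddZ_eq, Pi.div_apply, div_mul_cancel₀ _ (D_eichlerZ_ne_zero z)]

theorem mdifferentiable_div {F G : ℍ → ℂ} (hF : MDiff F) (hG : MDiff G) (h0 : ∀ z, G z ≠ 0) :
    MDiff (F / G) := by
  rw [UpperHalfPlane.mdifferentiable_iff] at *
  exact hF.div hG fun z _ => h0 _

theorem ddZ_mdifferentiable {F : ℍ → ℂ} (hF : MDiff F) : MDiff (ddZ F) := by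
  rw [ddZ_eq]
  exact mdifferentiable_div (normalizedDerivOfComplex_mdifferentiable hF)
    (normalizedDerivOfComplex_mdifferentiable eichlerZ_mdifferentiable) D_eichlerZ_ne_zero

/-! ### The logarithm of the Jacobian -/

/-- In weight 0 the defect in `D_slash` vanishes, so D(Z|₀γ) = (DZ)|₂γ, and the constant 1/6 cancels
in the quotient. -/
theorem ddZ_slash_eichlerZ (γ : GPlus) :
    ddZ (slash 0 γ eichlerZ) = slash 2 γ etaFour / etaFour := by
  rw [ddZ_eq, D_slash 0 γ eichlerZ_mdifferentiable, D_eichlerZ, slash_smul]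
  ext z
  have := etaFour_ne_zero z
  simp only [Pi.div_apply, Pi.sub_apply, Pi.smul_apply, smul_eq_mul, Nat.cast_zero, zero_mul,
    sub_zero, zero_add]
  field_simp

/-- A primitive g of h'/h exists on the disc. Then exp g and h have the same logarithmic derivative,
so h = c exp g with c ≠ 0, and log c is absorbed in g. -/
theorem exists_log_of_ball {h : ℂ → ℂ} (hd : DifferentiableOn ℂ h (Metric.ball 0 1))
    (h0 : ∀ w ∈ Metric.ball (0 : ℂ) 1, h w ≠ 0) :
    ∃ g : ℂ → ℂ, DifferentiableOn ℂ g (Metric.ball 0 1) ∧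
      ∀ w ∈ Metric.ball (0 : ℂ) 1, Complex.exp (g w) = h w := by
  have hl : DifferentiableOn ℂ (logDeriv h) (Metric.ball 0 1) :=
    (hd.deriv Metric.isOpen_ball).div hd h0
  obtain ⟨g, hg⟩ := hl.isExactOn_ball
  have hgd : DifferentiableOn ℂ g (Metric.ball 0 1) := fun w hw =>
    (hg w hw).differentiableAt.differentiableWithinAt
  have key : Set.EqOn (logDeriv h) (logDeriv (Complex.exp ∘ g)) (Metric.ball 0 1) := by
    intro w hw
    rw [logDeriv_comp Complex.differentiableAt_exp (hg w hw).differentiableAt, (hg w hw).deriv,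
      Complex.logDeriv_exp, Pi.one_apply, one_mul]
  rw [logDeriv_eqOn_iff hd (Complex.differentiable_exp.comp_differentiableOn hgd)
    Metric.isOpen_ball (convex_ball 0 1).isPreconnected (fun w _ => Complex.exp_ne_zero _) h0] at key
  obtain ⟨c, hc, e⟩ := key
  refine ⟨fun w => Complex.log c + g w, hgd.const_add _, fun w hw => ?_⟩
  rw [Complex.exp_add, Complex.exp_log hc, e hw]
  rfl

/-- A holomorphic function without zeros on the upper half-plane has a holomorphic logarithm. -/
theorem exists_log_of_mdifferentiable {J : ℍ → ℂ} (hJ : MDiff J) (h0 : ∀ z, J z ≠ 0) :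
    ∃ L : ℍ → ℂ, MDiff L ∧ ∀ z, Complex.exp (L z) = J z := by
  have hw1 : ∀ w ∈ Metric.ball (0 : ℂ) 1, 1 - w ≠ 0 := by
    intro w hw e
    rw [sub_eq_zero] at e
    simp [← e] at hw
  -- The Cayley transform and its inverse carry the problem to the unit disc and the logarithm back
  -- to ℍ.
  have hdisc : ∀ w ∈ Metric.ball (0 : ℂ) 1, 0 < (Complex.I * (1 + w) / (1 - w)).im := by
    intro w hw
    have hn : w.re * w.re + w.im * w.im < 1 := by
      rw [mem_ball_zero_iff] at hw
      rw [← Complex.normSq_apply, Complex.normSq_eq_norm_sq]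
      nlinarith [norm_nonneg w]
    have hs : 0 < Complex.normSq (1 - w) := Complex.normSq_pos.mpr (hw1 w hw)
    have e : (Complex.I * (1 + w) / (1 - w)).im
        = (1 - (w.re * w.re + w.im * w.im)) / Complex.normSq (1 - w) := by
      rw [Complex.div_im]
      simp
      ring
    rw [e]
    exact div_pos (by linarith) hs
  have hzI (z : ℍ) : (z : ℂ) + Complex.I ≠ 0 := by
    intro e
    have := congrArg Complex.im e
    have hz := z.im_pos
    simp at this
    linarith
  have hcayley (z : ℍ) : ((z : ℂ) - Complex.I) / (z + Complex.I) ∈ Metric.ball (0 : ℂ) 1 := by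
    rw [mem_ball_zero_iff, norm_div, div_lt_one (norm_pos_iff.mpr (hzI z))]
    refine lt_of_pow_lt_pow_left₀ 2 (norm_nonneg _) ?_
    rw [← Complex.normSq_eq_norm_sq, ← Complex.normSq_eq_norm_sq, Complex.normSq_apply,
      Complex.normSq_apply]
    have hz := z.im_pos
    simp
    nlinarith
  have hinv (z : ℍ) : Complex.I * (1 + ((z : ℂ) - Complex.I) / (z + Complex.I))
      / (1 - ((z : ℂ) - Complex.I) / (z + Complex.I)) = z := by
    have := hzI z
    have h2 := hw1 _ (hcayley z)
    have hI := Complex.I_ne_zero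
    have e1 : 1 + ((z : ℂ) - Complex.I) / (z + Complex.I) = 2 * z / (z + Complex.I) := by
      field_simp; ring
    have e2 : 1 - ((z : ℂ) - Complex.I) / (z + Complex.I) = 2 * Complex.I / (z + Complex.I) := by
      field_simp; ring
    rw [e1, e2]
    field_simp
  obtain ⟨g, hgd, hg⟩ := exists_log_of_ball
    (h := fun w => (J ∘ ofComplex) (Complex.I * (1 + w) / (1 - w)))
    (by
      have hc : DifferentiableOn ℂ (fun w : ℂ => Complex.I * (1 + w) / (1 - w))
          (Metric.ball 0 1) := DifferentiableOn.div (by fun_prop) (by fun_prop) hw1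
      exact DifferentiableOn.comp (g := J ∘ ofComplex)
        (UpperHalfPlane.mdifferentiable_iff.mp hJ) hc hdisc)
    (fun w hw => h0 _)
  refine ⟨fun z => g (((z : ℂ) - Complex.I) / (z + Complex.I)), ?_, fun z => ?_⟩
  · rw [UpperHalfPlane.mdifferentiable_iff]
    have hc : DifferentiableOn ℂ (fun z : ℂ => (z - Complex.I) / (z + Complex.I))
        {z : ℂ | 0 < z.im} :=
      DifferentiableOn.div (by fun_prop) (by fun_prop) fun z hz => hzI ⟨z, hz⟩
    refine (hgd.comp hc fun z hz => hcayley ⟨z, hz⟩).congr fun z hz => ?_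
    simp [ofComplex_apply_of_im_pos hz]
  · rw [hg _ (hcayley z), hinv, Function.comp_apply, ofComplex_apply]

theorem exists_isLogJacobian (γ : GPlus) : ∃ L : ℍ → ℂ, IsLogJacobian γ L := by
  obtain ⟨L, hL, e⟩ := exists_log_of_mdifferentiable
    (mdifferentiable_div (slash_mdifferentiable 2 γ etaFour_mdifferentiable)
      etaFour_mdifferentiable etaFour_ne_zero)
    (fun z => div_ne_zero (slash_ne_zero 2 γ etaFour_ne_zero z) (etaFour_ne_zero z))
  exact ⟨L, hL, fun z => (e z).trans (congrFun (ddZ_slash_eichlerZ γ) z).symm⟩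

/-- exp L is the quotient whose logarithmic derivative defines μ_γ. The choice of branch therefore
disappears after one derivative. -/
theorem IsLogJacobian.D_eq_mu {γ : GPlus} {L : ℍ → ℂ} (hL : IsLogJacobian γ L) : D L = mu γ := by
  ext z
  have e : slash 2 γ etaFour / etaFour = fun z => Complex.exp (L z) := by
    ext w; rw [hL.exp_eq, ddZ_slash_eichlerZ]
  have hd := (UpperHalfPlane.mdifferentiableAt_iff.mp (hL.holo z)).hasDerivAt.cexp
  have hd' : deriv ((fun z => Complex.exp (L z)) ∘ ofComplex) (z : ℂ)
      = Complex.exp (L z) * deriv (L ∘ ofComplex) z := by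
    have := hd.deriv
    simp only [Function.comp_apply, ofComplex_apply] at this
    exact this
  rw [mu, e]
  simp only [normalizedDerivOfComplex]
  rw [hd']
  field_simp

/-! ### The action of `δ_n` -/

/-- X is a derivation that kills DZ = η⁴/6 in weight 2, so it differentiates only F, and DF =
(dF/dZ) · DZ supplies one more factor DZ. -/
theorem ramanujan_higherDiff (n : ℕ) {F : ℍ → ℂ} (hF : MDiff F) :
    ramanujan (2 * n) (higherDiff n F) = higherDiff (n + 1) (ddZ F) := by
  have hZ := normalizedDerivOfComplex_mdifferentiable eichlerZ_mdifferentiable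
  have e : higherDiff n F = F * D eichlerZ ^ n := rfl
  have e' : D (D eichlerZ) = (6⁻¹ : ℂ) • (EisensteinSeries.E2 * D eichlerZ) := by
    nth_rewrite 1 [D_eichlerZ]
    rw [normalizedDerivOfComplex_smul _ _ etaFour_mdifferentiable, D_etaFour, D_eichlerZ,
      mul_smul_comm]
  ext z
  rw [ramanujan, D_etaFour_div, e, normalizedDerivOfComplex_mul _ _ hF (hZ.pow n),
    normalizedDerivOfComplex_pow _ _ hZ, e']
  simp only [higherDiff, Pi.add_apply, Pi.mul_apply, Pi.pow_apply, Pi.smul_apply, smul_eq_mul,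
    Pi.natCast_apply]
  rw [pow_succ' _ n, ← mul_assoc (ddZ F z), ddZ_mul_D]
  -- The derivative of the n-th power carries the truncated exponent n − 1, so n = 0 is treated
  -- apart.
  rcases n with _ | n
  · simp
  · rw [Nat.add_sub_cancel, pow_succ]
    push_cast
    ring

theorem iterate_ddZ_mdifferentiable {F : ℍ → ℂ} (hF : MDiff F) (n : ℕ) : MDiff (ddZ^[n] F) := by
  induction n with
  | zero => exact hF
  | succ n ih => rw [Function.iterate_succ_apply']; exact ddZ_mdifferentiable ih

theorem higherDiff_mdifferentiable {F : ℍ → ℂ} (hF : MDiff F) (n : ℕ) : MDiff (higherDiff n F) :=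
  hF.mul ((normalizedDerivOfComplex_mdifferentiable eichlerZ_mdifferentiable).pow n)

/-- Let h be the coefficient for δ_n. Then δ_{n+1} = Xδ_n − δ_nX multiplies by X(hf)/f − hX(f)/f,
formally X(h), which `ramanujan_higherDiff` evaluates. The weight is generalised because the
induction hypothesis is applied both to f and to X(f). -/
theorem IsModularAction.delta_apply {ρ : H1 →ₐ[ℂ] Module.End ℂ Crossed} (hρ : IsModularAction ρ)
    {γ : GPlus} {L : ℍ → ℂ} (hL : IsLogJacobian γ L) (n : ℕ+) (k : ℕ) (f : formsOfWeight k) :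
    ∃ g : formsOfWeight (k + 2 * (n : ℕ)),
      (g : ℍ → ℂ) = higherDiff n (ddZ^[n] L) * (f : ℍ → ℂ) ∧
      ρ (H1.delta n) (symb f γ) = symb g γ := by
  induction n using PNat.recOn generalizing k with
  | one =>
    obtain ⟨g, hg, e⟩ := hρ.delta_one_apply k f γ
    refine ⟨g, ?_, e⟩
    rw [hg, ← hL.D_eq_mu]
    ext z
    simp only [Pi.mul_apply, higherDiff, PNat.one_coe, Function.iterate_one, pow_one, ddZ_mul_D]
  | succ n ih =>
    obtain ⟨g, hg, eg⟩ := ih k f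
    obtain ⟨x, hx, ex⟩ := hρ.X_apply k f γ
    obtain ⟨g₁, hg₁, eg₁⟩ := hρ.X_apply _ g γ
    obtain ⟨g₂, hg₂, eg₂⟩ := ih _ x
    have hw : k + 2 + 2 * (n : ℕ) = k + 2 * ((n + 1 : ℕ+) : ℕ) := by
      rw [PNat.add_coe, PNat.one_coe]; ring
    have hw' : k + 2 * (n : ℕ) + 2 = k + 2 * ((n + 1 : ℕ+) : ℕ) := by
      rw [PNat.add_coe, PNat.one_coe]; ring
    have hF := iterate_ddZ_mdifferentiable hL.holo n
    have hsum : (g₁ : ℍ → ℂ)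
        = higherDiff (n + 1 : ℕ+) (ddZ^[(n + 1 : ℕ+)] L) * f + g₂ := by
      rw [hg₁, hg, hg₂, hx, add_comm k, ramanujan_mul _ _ (higherDiff_mdifferentiable hF n)
        (mdifferentiable_of_mem f.2), ramanujan_higherDiff n hF, PNat.add_coe, PNat.one_coe,
        Function.iterate_succ_apply']
    -- Modularity comes for free: the function is the difference X(hf) − hX(f) of two forms already
    -- known to be modular.
    have hmem : higherDiff (n + 1 : ℕ+) (ddZ^[(n + 1 : ℕ+)] L) * (f : ℍ → ℂ)
        ∈ formsOfWeight (k + 2 * ((n + 1 : ℕ+) : ℕ)) := by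
      rw [eq_sub_of_add_eq hsum.symm]
      exact Submodule.sub_mem _ (by rw [← hw']; exact g₁.2) (by rw [← hw]; exact g₂.2)
    refine ⟨⟨_, hmem⟩, rfl, ?_⟩
    have hrel : H1.delta (n + 1) + H1.delta n * H1.X = H1.X * H1.delta n := by
      rw [← H1.X_delta, sub_add_cancel]
    have hact := LinearMap.congr_fun (congrArg ρ hrel) (symb f γ)
    rw [map_add, map_mul, map_mul, LinearMap.add_apply, Module.End.mul_apply, Module.End.mul_apply,
      ex, eg, eg₁, eg₂] at hact
    have hsymb : symb (k := k + 2 * ((n + 1 : ℕ+) : ℕ)) ⟨_, hmem⟩ γ + symb g₂ γ = symb g₁ γ := by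
      rw [symb, symb, symb, ← SkewMonoidAlgebra.single_add]
      refine congrArg _ ((of_add_of hw'.symm (hw.trans hw'.symm) ?_))
      exact hsum.symm
    let _ : AddCommGroup Crossed := Module.addCommMonoidToAddCommGroup ℂ
    exact add_right_cancel (hact.trans hsymb.symm)

end ModularHecke

end

theorem mainTheorem12 :
    (∃! ρ : ModularHecke.H1 →ₐ[ℂ] Module.End ℂ ModularHecke.Crossed,
      ModularHecke.IsModularAction ρ) ∧
    (∀ z : UpperHalfPlane,
      HasDerivAt (ModularHecke.eichlerZ ∘ UpperHalfPlane.ofComplex)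
        (2 * Real.pi * Complex.I / 6 * ModularForm.eta (z : ℂ) ^ 4) (z : ℂ)) ∧
    (∀ γ : ModularHecke.GPlus, ∃ L : UpperHalfPlane → ℂ, ModularHecke.IsLogJacobian γ L) ∧
    ∀ ρ : ModularHecke.H1 →ₐ[ℂ] Module.End ℂ ModularHecke.Crossed,
      ModularHecke.IsModularAction ρ →
      ∀ (γ : ModularHecke.GPlus) (L : UpperHalfPlane → ℂ), ModularHecke.IsLogJacobian γ L →
      ∀ (n : ℕ+) (k : ℕ) (f : ModularHecke.formsOfWeight k),
        ∃ g : ModularHecke.formsOfWeight (k + 2 * (n : ℕ)),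
          (g : UpperHalfPlane → ℂ)
            = ModularHecke.higherDiff n (ModularHecke.ddZ^[n] L) * (f : UpperHalfPlane → ℂ) ∧
          ρ (ModularHecke.H1.delta n) (ModularHecke.symb f γ) = ModularHecke.symb g γ := by
  exact ⟨ModularHecke.existsUnique_isModularAction, ModularHecke.hasDerivAt_eichlerZ,
    ModularHecke.exists_isLogJacobian, fun _ hρ _ _ hL n k f => hρ.delta_apply hL n k f⟩
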